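/- Let $x$ be an element of a field $K$ that is transcendental over a subfield (for instance an indeterminate), and let $n\ge 2$. Let $G(\infty,\infty,n)$ be the group of $n\times n$ monomial matrices (exactly one nonzero entry in each row and in each column) whose nonzero entries are of the form $x^k$ with $k\in\mathbb Z$ and have product $1$. Let $X=\{t_i\ (i\in\mathbb Z),\ s_j\ (3\le j\le n)\}\subset G(\infty,\infty,n)$ be the set of Corran--Lee--Lee generators, where $$t_i=\begin{pmatrix}0&x^{-i}&0\\x^{i}&0&0\\0&0&I_{n-2}\end{pmatrix}$$ and $s_j$ is the permutation matrix exchanging the coordinates $j-1$ and $j$, and let $\lambda=\operatorname{diag}(x^{-(n-1)},x,\dots,x)$. Let $\ell(w)$ be the minimal length of a word over $X$ representing $w$. Write $v\preceq w$ if $w=vu$ for some $u$ with $\ell(w)=\ell(v)+\ell(u)$, and $v\preceq_r w$ if $\ell(wv^{-1})+\ell(v)=\ell(w)$; put $[1,w]=\{v: 1\preceq v\preceq w\}$ and $[1,w]_r=\{v: 1\preceq_r v\preceq_r w\}$. For $w\in G(\infty,\infty,n)$ let $M([1,w])$ be the monoid generated by a copy $\underline{[1,w]}=\{\underline v: v\in[1,w]\}$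 of $[1,w]$, with the relations $\underline v\,\underline u=\underline t$ whenever $v,u,t\in[1,w]$, $vu=t$ and $\ell(v)+\ell(u)=\ell(t)$, where $\underline 1$ is the unit of the monoid. A Garside monoid is a pair $(M,\Delta)$ of a monoid $M$ and an element $\Delta\in M$ such that: (1) there is $\nu:M\to\mathbb N$ with $\nu(fg)\ge\nu(f)+\nu(g)$ and $\nu(g)\ne0$ for $g\neq1$; (2) $M$ is cancellative; (3) any two elements of $M$ have a gcd and an lcm for left divisibility and for right divisibility; (4) the left divisors of $\Delta$ are the same as its right divisors, and they generate $M$. The divisors of $\Delta$ are called the simples (finiteness is not required). **Theorem.** For every integer $k\neq 0$, $(M([1,\lambda^k]),\underline{\lambda^k})$ is an interval Garside monoid with simples $\underline{[1,\lambda^k]}$. That is: $X$ generates $G(\infty,\infty,n)$ as a monoid, $\lambda^k$ is balanced (i.e. $[1,\lambda^k]=[1,\lambda^k]_r$), both posets $([1,\lambda^k],\preceq)$ and $([1,\lambda^k]_r,\preceq_r)$ are lattices, $(M([1,\lambda^k]),\underline{\lambda^k})$ is a Garside monoid, and $v\mapsto\underline v$ is a bijection from $[1,\lambda^k]$ onto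 the set of divisors of $\underline{\lambda^k}$. Moreover, the group of fractions $G([1,\lambda^k])$ of $M([1,\lambda^k])$ exists: there are a group $G$ and an injective homomorphism $\iota:M([1,\lambda^k])\to G$ such that every element of $G$ can be written as $\iota(a)\iota(b)^{-1}$ and as $\iota(c)^{-1}\iota(d)$, and every homomorphism from $M([1,\lambda^k])$ to a group factors uniquely through $\iota$. -/

import Mathlib

/-! ### Divisibility, Garside monoids, groups of fractions -/

section Garside

/-- `f` left-divides `g`. -/
def LeftDivides {M : Type*} [Monoid M] (f g : M) : Prop := ∃ g' : M, f * g' = g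

/-- `f` right-divides `g`. -/
def RightDivides {M : Type*} [Monoid M] (f g : M) : Prop := ∃ g' : M, g' * f = g

/-- `d` is a greatest common lower bound of `f` and `g` for the relation `r`. -/
def IsGcdFor {M : Type*} (r : M → M → Prop) (f g d : M) : Prop :=
  r d f ∧ r d g ∧ ∀ e, r e f → r e g → r e d

/-- `m` is a least common upper bound of `f` and `g` for the relation `r`. -/
def IsLcmFor {M : Type*} (r : M → M → Prop) (f g m : M) : Prop :=
  r f m ∧ r g m ∧ ∀ e, r f e → r g e → r m e

/-- `(M, Δ)` is a Garside monoid. The set of simples is not required to be finite. -/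
structure IsGarsideMonoid (M : Type*) [Monoid M] (Δ : M) : Prop where
  exists_superadditive : ∃ ν : M → ℕ, (∀ f g, ν f + ν g ≤ ν (f * g)) ∧ ∀ g, g ≠ 1 → ν g ≠ 0
  cancellative : ∀ h f g k : M, h * f * k = h * g * k → f = g
  exists_left_gcd : ∀ f g : M, ∃ d, IsGcdFor LeftDivides f g d
  exists_left_lcm : ∀ f g : M, ∃ m, IsLcmFor LeftDivides f g m
  exists_right_gcd : ∀ f g : M, ∃ d, IsGcdFor RightDivides f g d
  exists_right_lcm : ∀ f g : M, ∃ m, IsLcmFor RightDivides f g m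
  divisors_eq : {s : M | LeftDivides s Δ} = {s : M | RightDivides s Δ}
  divisors_generate : Submonoid.closure {s : M | LeftDivides s Δ} = ⊤

/-- `ι : M →* G` exhibits `G` as the group of fractions of `M`: `M` embeds in `G`, every element
of `G` is a right fraction and a left fraction of elements of `M`, and `G` is the universal group
receiving a homomorphism from `M`. -/
structure IsGroupOfFractions.{u} {M G : Type u} [Monoid M] [Group G] (ι : M →* G) : Prop where
  injective : Function.Injective ι
  right_fraction : ∀ g : G, ∃ a b : M, g = ι a * (ι b)⁻¹
  left_fraction : ∀ g : G, ∃ a b : M, g = (ι b)⁻¹ * ι a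
  universal : ∀ (H : Type u) [Group H] (f : M →* H), ∃! F : G →* H, F.comp ι = f

end Garside

/-! ### Intervals in a group with respect to a generating set -/

section Interval

variable {W : Type*} [Group W]

/-- The length of `w` over `S`: the minimal length of a word over `S` that represents `w`. -/
noncomputable def wordLength (S : Set W) (w : W) : ℕ :=
  sInf {m : ℕ | ∃ l : List W, (∀ s ∈ l, s ∈ S) ∧ l.prod = w ∧ l.length = m}

/-- The relation `v ≼ w`: `w = v * u` for some `u` with `ℓ(w) = ℓ(v) + ℓ(u)`. -/
def DivL (S : Set W) (v w : W) : Prop :=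
  ∃ u : W, w = v * u ∧ wordLength S w = wordLength S v + wordLength S u

/-- The relation `v ≼ᵣ w`: `ℓ(w v⁻¹) + ℓ(v) = ℓ(w)`. -/
def DivR (S : Set W) (v w : W) : Prop :=
  wordLength S (w * v⁻¹) + wordLength S v = wordLength S w

/-- The interval `[1, w]` for `≼`. -/
def intervalL (S : Set W) (w : W) : Set W := {v | DivL S 1 v ∧ DivL S v w}

/-- The interval `[1, w]ᵣ` for `≼ᵣ`. -/
def intervalR (S : Set W) (w : W) : Set W := {v | DivR S 1 v ∧ DivR S v w}

/-- `w` is balanced if `[1, w] = [1, w]ᵣ`. -/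
def IsBalanced (S : Set W) (w : W) : Prop := intervalL S w = intervalR S w

theorem wordLength_one (S : Set W) : wordLength S (1 : W) = 0 :=
  Nat.sInf_eq_zero.2 (Or.inl ⟨[], by simp, rfl, rfl⟩)

theorem one_mem_intervalL (S : Set W) (w : W) : (1 : W) ∈ intervalL S w :=
  ⟨⟨1, by simp, by simp [wordLength_one]⟩, ⟨w, by simp, by simp [wordLength_one]⟩⟩

theorem self_mem_intervalL (S : Set W) (w : W) : w ∈ intervalL S w :=
  ⟨⟨w, by simp, by simp [wordLength_one]⟩, ⟨1, by simp, by simp [wordLength_one]⟩⟩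

/-- The relation `r`, restricted to the set `s`, is a partial order that is a lattice. -/
def IsLatticeOn {A : Type*} (s : Set A) (r : A → A → Prop) : Prop :=
  ∃ L : Lattice s, ∀ a b : s, L.le a b ↔ r a b

/-- The defining relations of the interval monoid on the generating set `[1, w]`: the product of
the generators `v` and `u` is the generator `t` when `v u = t` in `W` with
`ℓ(v) + ℓ(u) = ℓ(t)`, and the generator attached to `1` is the unit. The second relation makes
explicit that the generator attached to `1` is not a new idempotent. -/
inductive IntervalRel (S : Set W) (w : W) :
    FreeMonoid (intervalL S w) → FreeMonoid (intervalL S w) → Prop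
  | mul (v u t : intervalL S w) (h : (v : W) * u = t)
      (hl : wordLength S (v : W) + wordLength S (u : W) = wordLength S (t : W)) :
      IntervalRel S w (FreeMonoid.of v * FreeMonoid.of u) (FreeMonoid.of t)
  | one : IntervalRel S w (FreeMonoid.of ⟨1, one_mem_intervalL S w⟩) 1

/-- The interval monoid `M([1, w])`. -/
abbrev IntervalMonoid (S : Set W) (w : W) : Type _ := PresentedMonoid (IntervalRel S w)

/-- The generator of `M([1, w])` attached to an element of `[1, w]`. -/
def intervalGen (S : Set W) (w : W) (v : intervalL S w) : IntervalMonoid S w :=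
  PresentedMonoid.of (IntervalRel S w) v

/-- The element of `M([1, w])` attached to `w` itself. -/
def intervalTop (S : Set W) (w : W) : IntervalMonoid S w :=
  intervalGen S w ⟨w, self_mem_intervalL S w⟩

/-- `M([1, w])`, together with the element attached to `w`, is an interval Garside monoid whose
simples are the copy of `[1, w]`. -/
structure IsIntervalGarsideMonoid (S : Set W) (w : W) : Prop where
  positively_generated : Submonoid.closure S = ⊤
  balanced : IsBalanced S w
  lattice_left : IsLatticeOn (intervalL S w) (DivL S)
  lattice_right : IsLatticeOn (intervalR S w) (DivR S)
  garside : IsGarsideMonoid (IntervalMonoid S w) (intervalTop S w)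
  gen_injective : Function.Injective (intervalGen S w)
  simples_eq : {s | LeftDivides s (intervalTop S w)} = Set.range (intervalGen S w)

end Interval

/-! ### The group `G(∞,∞,n)` -/

section GInf

variable {K : Type*} [Field K] {n : ℕ}

open Classical in
/-- `A` is monomial (each row and each column has exactly one nonzero entry), its nonzero entries
are powers of `x`, and the product of its nonzero entries is `1`. -/
structure IsGInfMatrix (x : Kˣ) (A : Matrix (Fin n) (Fin n) K) : Prop where
  row : ∀ i, ∃! j, A i j ≠ 0
  col : ∀ j, ∃! i, A i j ≠ 0
  entry : ∀ i j, A i j ≠ 0 → ∃ k : ℤ, A i j = ((x ^ k : Kˣ) : K)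
  prod : ∏ p : Fin n × Fin n with A p.1 p.2 ≠ 0, A p.1 p.2 = 1

/-- The monomial matrix with entry `u i` in row `i` and column `σ i`. -/
def monoMatrix (σ : Equiv.Perm (Fin n)) (u : Fin n → Kˣ) : Matrix (Fin n) (Fin n) K :=
  Matrix.of fun i j => if σ i = j then (u i : K) else 0

theorem monoMatrix_mul (σ τ : Equiv.Perm (Fin n)) (u v : Fin n → Kˣ) :
    monoMatrix σ u * monoMatrix τ v = monoMatrix (τ * σ) (fun i => u i * v (σ i)) := by
  ext i j
  rw [Matrix.mul_apply, Finset.sum_eq_single (σ i)]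
  · by_cases h : τ (σ i) = j <;> simp [monoMatrix, h]
  · intro b _ hb
    simp [monoMatrix, hb.symm]
  · simp

theorem monoMatrix_one : monoMatrix (1 : Equiv.Perm (Fin n)) (fun _ => (1 : Kˣ)) = 1 := by
  ext i j
  by_cases h : i = j <;> simp [monoMatrix, Matrix.one_apply, h]

theorem monoMatrix_ne_zero (σ : Equiv.Perm (Fin n)) (u : Fin n → Kˣ) (i j : Fin n) :
    monoMatrix σ u i j ≠ 0 ↔ σ i = j := by
  simp [monoMatrix]

theorem prod_monoMatrix (σ : Equiv.Perm (Fin n)) (u : Fin n → Kˣ)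
    [DecidablePred fun p : Fin n × Fin n => monoMatrix σ u p.1 p.2 ≠ 0] :
    ∏ p : Fin n × Fin n with monoMatrix σ u p.1 p.2 ≠ 0, monoMatrix σ u p.1 p.2 =
      ((∏ i, u i : Kˣ) : K) := by
  rw [Units.coe_prod]
  symm
  refine Finset.prod_bij (fun i _ => (i, σ i)) ?_ ?_ ?_ ?_
  · intro i _
    simp [monoMatrix_ne_zero]
  · intro i _ j _ h
    exact (Prod.mk.inj h).1
  · rintro ⟨i, j⟩ h
    have h' : σ i = j := by simpa [monoMatrix_ne_zero] using h
    exact ⟨i, Finset.mem_univ _, by rw [h']⟩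
  · intro i _
    simp [monoMatrix]

/-- The elements of `G(∞,∞,n)` in terms of permutations and diagonal parts. -/
theorem isGInfMatrix_iff (x : Kˣ) (A : Matrix (Fin n) (Fin n) K) :
    IsGInfMatrix x A ↔ ∃ (σ : Equiv.Perm (Fin n)) (u : Fin n → Kˣ),
      (∀ i, u i ∈ Subgroup.zpowers x) ∧ ∏ i, u i = 1 ∧ A = monoMatrix σ u := by
  classical
  constructor
  · intro h
    choose f hf hf' using h.row
    have hinj : Function.Injective f := fun i i' hii => by
      obtain ⟨r, -, hr⟩ := h.col (f i)
      rw [hr i (hf i), hr i' (by have := hf i'; rwa [← hii] at this)]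
    let σ : Equiv.Perm (Fin n) := Equiv.ofBijective f (Finite.injective_iff_bijective.1 hinj)
    let u : Fin n → Kˣ := fun i => Units.mk0 (A i (f i)) (hf i)
    have hA : A = monoMatrix σ u := by
      ext i j
      by_cases hij : f i = j
      · subst hij
        simp [monoMatrix, σ, u]
      · have h0 : A i j = 0 := by
          by_contra hne
          exact hij (hf' i j hne).symm
        simp [monoMatrix, σ, hij, h0]
    refine ⟨σ, u, fun i => ?_, ?_, hA⟩
    · obtain ⟨k, hk⟩ := h.entry i (f i) (hf i)
      exact ⟨k, Units.ext (by simpa [u] using hk.symm)⟩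
    · have hp := h.prod
      rw [hA] at hp
      apply Units.ext
      rw [← prod_monoMatrix σ u, Units.val_one, ← hp]
  · rintro ⟨σ, u, hu, hp, rfl⟩
    refine ⟨fun i => ⟨σ i, ?_, ?_⟩, fun j => ⟨σ.symm j, ?_, ?_⟩, fun i j hij => ?_, ?_⟩
    · exact (monoMatrix_ne_zero σ u _ _).2 rfl
    · exact fun j hj => ((monoMatrix_ne_zero σ u _ _).1 hj).symm
    · exact (monoMatrix_ne_zero σ u _ _).2 (by simp)
    · exact fun i hi => by simp [← (monoMatrix_ne_zero σ u _ _).1 hi]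
    · obtain ⟨k, hk⟩ := hu i
      refine ⟨k, ?_⟩
      have hk' : x ^ k = u i := hk
      rw [hk']
      simp [monoMatrix, (monoMatrix_ne_zero σ u _ _).1 hij]
    · rw [prod_monoMatrix, hp, Units.val_one]

/-- The group `G(∞,∞,n)` as a subgroup of `GL n K`. -/
def GInf (x : Kˣ) (n : ℕ) : Subgroup (GL (Fin n) K) where
  carrier := {g | IsGInfMatrix x (g : Matrix (Fin n) (Fin n) K)}
  one_mem' := (isGInfMatrix_iff _ _).2
    ⟨1, fun _ => 1, fun _ => one_mem _, by simp, by simp [monoMatrix_one]⟩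
  mul_mem' := by
    intro a b ha hb
    obtain ⟨σ, u, hu, hp, ha⟩ := (isGInfMatrix_iff _ _).1 ha
    obtain ⟨τ, v, hv, hq, hb⟩ := (isGInfMatrix_iff _ _).1 hb
    refine (isGInfMatrix_iff _ _).2 ⟨τ * σ, fun i => u i * v (σ i),
      fun i => mul_mem (hu i) (hv _), ?_, ?_⟩
    · rw [Finset.prod_mul_distrib, hp, Equiv.prod_comp σ v, hq, one_mul]
    · rw [← monoMatrix_mul, ← ha, ← hb]
      rfl
  inv_mem' := by
    intro a ha
    obtain ⟨σ, u, hu, hp, ha⟩ := (isGInfMatrix_iff _ _).1 ha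
    refine (isGInfMatrix_iff _ _).2 ⟨σ⁻¹, fun i => (u (σ⁻¹ i))⁻¹,
      fun i => inv_mem (hu _), ?_, ?_⟩
    · rw [Finset.prod_inv_distrib, Equiv.prod_comp σ⁻¹ u, hp, inv_one]
    · have h : (a : Matrix (Fin n) (Fin n) K) *
          monoMatrix σ⁻¹ (fun i => (u (σ⁻¹ i))⁻¹) = 1 := by
        rw [ha, monoMatrix_mul, ← monoMatrix_one]
        simp
      rw [Matrix.coe_units_inv]
      exact Matrix.inv_eq_right_inv h

/-- The matrix `t_k`: the block with rows `(0, x^{-k})` and `(x^k, 0)` in the upper left corner and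
the identity in the remaining positions. -/
def tMatrix (x : Kˣ) (n : ℕ) (k : ℤ) : Matrix (Fin n) (Fin n) K :=
  Matrix.of fun i j =>
    if i.val = 0 ∧ j.val = 1 then ((x ^ (-k) : Kˣ) : K)
    else if i.val = 1 ∧ j.val = 0 then ((x ^ k : Kˣ) : K)
    else if i = j ∧ 2 ≤ i.val then 1
    else 0

/-- The matrix `s_j`, for `3 ≤ j ≤ n`: the permutation matrix that exchanges the coordinates
`j - 1` and `j` (numbered from `1`; their values in `Fin n` are `j - 2` and `j - 1`). -/
def sMatrix (K : Type*) [Field K] (n j : ℕ) : Matrix (Fin n) (Fin n) K :=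
  Matrix.of fun a b =>
    if a.val + 2 = j ∧ b.val + 1 = j then 1
    else if a.val + 1 = j ∧ b.val + 2 = j then 1
    else if a = b ∧ a.val + 2 ≠ j ∧ a.val + 1 ≠ j then 1
    else 0

/-- The set `X` of Corran--Lee--Lee generators `t_k` (`k ∈ ℤ`), `s_j` (`3 ≤ j ≤ n`)
of `G(∞,∞,n)`. -/
def genX (x : Kˣ) (n : ℕ) : Set (GInf x n) :=
  {g | (∃ k : ℤ, ((g : GL (Fin n) K) : Matrix (Fin n) (Fin n) K) = tMatrix x n k) ∨
    ∃ j : ℕ, 3 ≤ j ∧ j ≤ n ∧ ((g : GL (Fin n) K) : Matrix (Fin n) (Fin n) K) = sMatrix K n j}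

theorem exists_monoMatrix (x : Kˣ) (σ : Equiv.Perm (Fin n)) (u : Fin n → Kˣ)
    (hu : ∀ i, u i ∈ Subgroup.zpowers x) (hp : ∏ i, u i = 1) :
    ∃ g : GInf x n, ((g : GL (Fin n) K) : Matrix (Fin n) (Fin n) K) = monoMatrix σ u :=
  ⟨⟨⟨monoMatrix σ u, monoMatrix σ⁻¹ (fun i => (u (σ⁻¹ i))⁻¹),
    by rw [monoMatrix_mul, ← monoMatrix_one]; simp,
    by rw [monoMatrix_mul, ← monoMatrix_one]; simp⟩,
    (isGInfMatrix_iff _ _).2 ⟨σ, u, hu, hp, rfl⟩⟩, rfl⟩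

/-- For `n ≥ 2` every matrix `t_k` is an element of `G(∞,∞,n)`. -/
theorem exists_tMatrix (x : Kˣ) (hn : 2 ≤ n) (k : ℤ) :
    ∃ g : GInf x n, ((g : GL (Fin n) K) : Matrix (Fin n) (Fin n) K) = tMatrix x n k := by
  obtain ⟨m, rfl⟩ := Nat.exists_eq_add_of_le' hn
  obtain ⟨g, hg⟩ := exists_monoMatrix x (Equiv.swap (0 : Fin (m + 2)) 1)
    (fun i => if i.val = 0 then x ^ (-k) else if i.val = 1 then x ^ k else 1)
    (fun i => by
      split_ifs
      · exact ⟨_, rfl⟩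
      · exact ⟨_, rfl⟩
      · exact one_mem _)
    (by simp [Fin.prod_univ_succ])
  refine ⟨g, hg.trans ?_⟩
  ext i j
  simp only [monoMatrix, tMatrix, Matrix.of_apply, Equiv.swap_apply_def, Fin.ext_iff,
    Fin.val_zero, Fin.val_one]
  split_ifs <;> first | rfl | omega | (simp [-Fin.val_eq_zero_iff] at *; done) |
    (simp [-Fin.val_eq_zero_iff] at *; omega)

/-- Every matrix `s_j`, for `3 ≤ j ≤ n`, is an element of `G(∞,∞,n)`. -/
theorem exists_sMatrix (x : Kˣ) (j : ℕ) (hj : 3 ≤ j) (hjn : j ≤ n) :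
    ∃ g : GInf x n, ((g : GL (Fin n) K) : Matrix (Fin n) (Fin n) K) = sMatrix K n j := by
  obtain ⟨g, hg⟩ := exists_monoMatrix x
    (Equiv.swap (⟨j - 2, by omega⟩ : Fin n) ⟨j - 1, by omega⟩) (fun _ => 1)
    (fun _ => one_mem _) (by simp)
  refine ⟨g, hg.trans ?_⟩
  ext a b
  simp only [monoMatrix, sMatrix, Matrix.of_apply, Equiv.swap_apply_def, Fin.ext_iff, Units.val_one]
  split_ifs <;> first | rfl | omega | (simp at *; done) | (simp at *; omega)

/-- The diagonal entries `x^{-(n-1)}, x, …, x` of `λ`. -/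
def lamDiag (x : Kˣ) (n : ℕ) : Fin n → Kˣ :=
  fun i => if i.val = 0 then x ^ (-((n : ℤ) - 1)) else x

theorem prod_lamDiag (x : Kˣ) (n : ℕ) : ∏ i, lamDiag x n i = 1 := by
  cases n with
  | zero => simp
  | succ m =>
    rw [Fin.prod_univ_succ]
    simp [lamDiag]

/-- The element `λ` of `G(∞,∞,n)`, the diagonal matrix with entries `x^{-(n-1)}, x, …, x`. -/
def lam (x : Kˣ) (n : ℕ) : GInf x n :=
  ⟨⟨Matrix.diagonal fun i => (lamDiag x n i : K),
    Matrix.diagonal fun i => ((lamDiag x n i)⁻¹ : Kˣ), by simp, by simp⟩, by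
    refine (isGInfMatrix_iff _ _).2 ⟨1, lamDiag x n, fun i => ?_, prod_lamDiag x n, ?_⟩
    · unfold lamDiag
      split_ifs
      · exact ⟨_, rfl⟩
      · exact Subgroup.mem_zpowers x
    · ext i j
      by_cases h : i = j <;> simp [monoMatrix, h]⟩

end GInf

/-! ### Meets from joins -/

/-! The proof rests on an explicit length formula. An element is a permutation of rows together with
row exponents. A pair of rows `i < j` costs 1 if it is inverted; if it is in order, it costs 2 or 0
according to whether the exponent of row `j` is nonzero. The sum of these costs is subadditive pair
by pair (`pairCost_mul`) and equals the word length (`wordLength_eq_cost`). Hence `v ≼ w` is a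
conjunction of conditions on single pairs (`divL_genX_iff`), and `[1, λ^k]` consists of the elements
in which every pair in order has lower exponent 0 or `k` (`mem_intervalL_lam_zpow`). This
description is invariant under transposition, an anti-automorphism that preserves length and fixes
`λ^k`, so `λ^k` is balanced and each left-hand statement yields its right-hand version.

Joins reduce to joins of two generators (`IsBalanced.exists_join`), which are explicit. Distant
generators commute, adjacent ones satisfy a braid relation, and two different `t_i`, `t_j` have as
join the diagonal matrix with `x^{-k}`, `x^k` in the first two rows. Meets follow because lengths
are bounded.

The rest holds for any balanced interval with joins and such a reversal. The complement `v \ s` of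
simples extends to an action of the whole interval monoid (`IsJoinInterval.transducer`). Since `s \
(s a) = a`, the monoid is left cancellative, and lcms are built one generator at a time.
Cancellation and common multiples then give the group of fractions by Ore's construction. -/

theorem exists_gcd_of_exists_lcm {M : Type*} (r : M → M → Prop) (ν : M → ℕ)
    (hmono : ∀ a b, r a b → ν a ≤ ν b) (heq : ∀ a b, r a b → ν a = ν b → a = b)
    (bot : M) (hbot : ∀ a, r bot a) (hlcm : ∀ f g, ∃ m, IsLcmFor r f g m) (f g : M) :
    ∃ d, IsGcdFor r f g d := by
  -- Ranks of common lower bounds. One of largest rank is the gcd: its join with any other common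
  -- lower bound is again a common lower bound, so it cannot have larger rank.
  let A : Set ℕ := {m | ∃ d, r d f ∧ r d g ∧ ν d = m}
  have hA : sSup A ∈ A := Nat.sSup_mem ⟨ν bot, bot, hbot f, hbot g, rfl⟩
    ⟨ν f, by rintro _ ⟨d, hd, -, rfl⟩; exact hmono _ _ hd⟩
  have hbdd : BddAbove A := ⟨ν f, by rintro _ ⟨d, hd, -, rfl⟩; exact hmono _ _ hd⟩
  obtain ⟨d, hdf, hdg, hd⟩ := hA
  refine ⟨d, hdf, hdg, fun e hef heg => ?_⟩
  obtain ⟨m, hdm, hem, hm⟩ := hlcm d e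
  have hle : ν m ≤ ν d := hd ▸ le_csSup hbdd ⟨m, hm _ hdf hef, hm _ hdg heg, rfl⟩
  rw [heq d m hdm (le_antisymm (hmono _ _ hdm) hle)]
  exact hem

/-- A graded poset of bounded rank has joins as soon as two elements that cover a common element
(in the sense of a relation `C`) have a join. -/
theorem exists_lcm_of_local {A : Type*} (r : A → A → Prop) (hrefl : ∀ a, r a a)
    (htrans : ∀ a b c, r a b → r b c → r a c) (ν : A → ℕ) (N : ℕ) (hN : ∀ a, ν a ≤ N)
    (hmono : ∀ a b, r a b → ν a ≤ ν b) (C : A → A → Prop)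
    (hCν : ∀ z a, C z a → ν z < ν a)
    (hC : ∀ z a, r z a → z ≠ a → ∃ b, C z b ∧ r b a)
    (hloc : ∀ z a b, C z a → C z b → ∃ m, IsLcmFor r a b m) :
    ∀ z a b, r z a → r z b → ∃ m, IsLcmFor r a b m := by
  -- Induction on the corank `N - ν z` of the common lower bound.
  have key : ∀ d z, N - ν z = d → ∀ a b, r z a → r z b → ∃ m, IsLcmFor r a b m := by
    intro d
    induction d using Nat.strong_induction_on with
    | _ d ih =>
      intro z hz a b hza hzb
      by_cases ha : z = a
      · subst ha
        exact ⟨b, hzb, hrefl b, fun e _ he => he⟩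
      by_cases hb : z = b
      · subst hb
        exact ⟨a, hrefl a, hza, fun e he _ => he⟩
      obtain ⟨a', hCa, ha'⟩ := hC z a hza ha
      obtain ⟨b', hCb, hb'⟩ := hC z b hzb hb
      obtain ⟨j, hja, hjb, hj⟩ := hloc z a' b' hCa hCb
      have h1 := hCν _ _ hCa
      have h2 := hCν _ _ hCb
      have h3 := hmono _ _ hja
      have h4 := hN a'
      have h5 := hN b'
      have h6 := hN j
      -- The local join `j` serves as a bridge: `a` and `j` share the lower bound `a'`, `b` and `j`
      -- share `b'`, and the two resulting joins share `j`, all three of smaller corank than `z`.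
      obtain ⟨p, hap, hjp, hp⟩ := ih (N - ν a') (by omega) a' rfl a j ha' hja
      obtain ⟨q, hbq, hjq, hq⟩ := ih (N - ν b') (by omega) b' rfl b j hb' hjb
      obtain ⟨m, hpm, hqm, hm⟩ := ih (N - ν j) (by omega) j rfl p q hjp hjq
      refine ⟨m, htrans _ _ _ hap hpm, htrans _ _ _ hbq hqm, fun e hae hbe => ?_⟩
      have hje : r j e := hj e (htrans _ _ _ ha' hae) (htrans _ _ _ hb' hbe)
      exact hm e (hp e hae hje) (hq e hbe hje)
  exact fun z => key _ z rfl

theorem isLatticeOn_of_exists {A : Type*} (s : Set A) (r : A → A → Prop)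
    (hrefl : ∀ a, r a a) (htrans : ∀ a b c, r a b → r b c → r a c)
    (hanti : ∀ a b, r a b → r b a → a = b)
    (hsup : ∀ a b : s, ∃ m, IsLcmFor (fun x y : s => r x y) a b m)
    (hinf : ∀ a b : s, ∃ m, IsGcdFor (fun x y : s => r x y) a b m) : IsLatticeOn s r := by
  choose j hj using hsup
  choose i hi using hinf
  exact ⟨{ le := fun a b => r a b
           le_refl := fun a => hrefl a
           le_trans := fun a b c => htrans a b c
           le_antisymm := fun a b h h' => Subtype.ext (hanti _ _ h h')
           sup := j
           inf := i
           le_sup_left := fun a b => (hj a b).1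
           le_sup_right := fun a b => (hj a b).2.1
           sup_le := fun a b c h h' => (hj a b).2.2 c h h'
           inf_le_left := fun a b => (hi a b).1
           inf_le_right := fun a b => (hi a b).2.1
           le_inf := fun a b c h h' => (hi b c).2.2 a h h' }, fun _ _ => Iff.rfl⟩

/-! ### Word length -/

section WordLength

variable {W : Type*} [Group W] {S : Set W}

theorem exists_reduced_word (hS : Submonoid.closure S = ⊤) (w : W) :
    ∃ l : List W, (∀ s ∈ l, s ∈ S) ∧ l.prod = w ∧ l.length = wordLength S w := by
  have hw : w ∈ Submonoid.closure S := hS ▸ Submonoid.mem_top w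
  obtain ⟨l, hl, hp⟩ := Submonoid.exists_list_of_mem_closure hw
  exact Nat.sInf_mem (s := {m : ℕ | ∃ l : List W, (∀ s ∈ l, s ∈ S) ∧ l.prod = w ∧ l.length = m})
    ⟨l.length, l, hl, hp, rfl⟩

theorem wordLength_prod_le (l : List W) (hl : ∀ s ∈ l, s ∈ S) :
    wordLength S l.prod ≤ l.length :=
  Nat.sInf_le ⟨l, hl, rfl, rfl⟩

theorem wordLength_mul_le (hS : Submonoid.closure S = ⊤) (v w : W) :
    wordLength S (v * w) ≤ wordLength S v + wordLength S w := by
  obtain ⟨l, hl, rfl, hl'⟩ := exists_reduced_word hS v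
  obtain ⟨m, hm, rfl, hm'⟩ := exists_reduced_word hS w
  rw [← hl', ← hm', ← List.length_append, ← List.prod_append]
  exact wordLength_prod_le _ fun s hs => (List.mem_append.1 hs).elim (hl s) (hm s)

theorem wordLength_eq_zero (hS : Submonoid.closure S = ⊤) {w : W} (h : wordLength S w = 0) :
    w = 1 := by
  obtain ⟨l, -, rfl, hl'⟩ := exists_reduced_word hS w
  rw [List.eq_nil_of_length_eq_zero (hl'.trans h), List.prod_nil]

theorem divL_iff {v w : W} :
    DivL S v w ↔ wordLength S w = wordLength S v + wordLength S (v⁻¹ * w) := by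
  constructor
  · rintro ⟨u, rfl, h⟩
    rwa [inv_mul_cancel_left]
  · exact fun h => ⟨v⁻¹ * w, by group, h⟩

theorem divL_mul_iff {v u : W} :
    DivL S v (v * u) ↔ wordLength S (v * u) = wordLength S v + wordLength S u := by
  rw [divL_iff, inv_mul_cancel_left]

theorem DivL.refl (v : W) : DivL S v v := ⟨1, by simp, by simp [wordLength_one]⟩

theorem one_divL (v : W) : DivL S 1 v := ⟨v, by simp, by simp [wordLength_one]⟩

theorem DivL.wordLength_le {v w : W} (h : DivL S v w) : wordLength S v ≤ wordLength S w := by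
  obtain ⟨u, -, h⟩ := h
  omega

theorem DivL.eq_of_wordLength_eq (hS : Submonoid.closure S = ⊤) {v w : W} (h : DivL S v w)
    (h' : wordLength S v = wordLength S w) : v = w := by
  obtain ⟨u, rfl, h⟩ := h
  rw [wordLength_eq_zero hS (w := u) (by omega), mul_one]

theorem DivL.antisymm (hS : Submonoid.closure S = ⊤) {v w : W} (h : DivL S v w)
    (h' : DivL S w v) : v = w :=
  h.eq_of_wordLength_eq hS (le_antisymm h.wordLength_le h'.wordLength_le)

theorem DivL.trans (hS : Submonoid.closure S = ⊤) {u v w : W} (h : DivL S u v)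
    (h' : DivL S v w) : DivL S u w := by
  obtain ⟨a, rfl, ha⟩ := h
  obtain ⟨b, rfl, hb⟩ := h'
  refine ⟨a * b, mul_assoc _ _ _, ?_⟩
  have h1 := wordLength_mul_le hS u (a * b)
  have h2 := wordLength_mul_le hS a b
  rw [← mul_assoc] at h1
  omega

/-- Left translation: below `v * x`, multiplication by `v` is order preserving. -/
theorem DivL.mul_left (hS : Submonoid.closure S = ⊤) {v x y : W} (h : DivL S v (v * x))
    (hy : DivL S y x) : DivL S v (v * y) ∧ DivL S (v * y) (v * x) := by
  obtain ⟨z, rfl, hz⟩ := hy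
  rw [divL_mul_iff] at h
  have h1 := wordLength_mul_le hS v y
  have h2 := wordLength_mul_le hS (v * y) z
  rw [mul_assoc] at h2
  rw [divL_mul_iff, ← mul_assoc, divL_mul_iff, mul_assoc]
  omega

/-- The hypotheses give `ℓ(v x) = ℓ(v) + ℓ(y) + ℓ(y⁻¹ x)`, so subadditivity is an equality
throughout. Together with `DivL.mul_left`, this allows a common prefix `v` to be added or cancelled.
-/
theorem DivL.of_mul_left (hS : Submonoid.closure S = ⊤) {v x y : W} (h : DivL S v (v * y))
    (hy : DivL S (v * y) (v * x)) : DivL S v (v * x) ∧ DivL S y x := by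
  refine ⟨h.trans hS hy, ?_⟩
  rw [divL_mul_iff] at h
  rw [divL_iff] at hy ⊢
  have e : (v * y)⁻¹ * (v * x) = y⁻¹ * x := by group
  rw [e] at hy
  have h1 := wordLength_mul_le hS v x
  have h2 := wordLength_mul_le hS y (y⁻¹ * x)
  rw [mul_inv_cancel_left] at h2
  omega

theorem exists_generator_divL (hS : Submonoid.closure S = ⊤) {w : W} (hw : w ≠ 1) :
    ∃ s ∈ S, wordLength S s = 1 ∧ DivL S s w := by
  obtain ⟨l, hl, rfl, hl'⟩ := exists_reduced_word hS w
  cases l with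
  | nil => exact absurd rfl hw
  | cons s l =>
    have h1 := wordLength_prod_le (S := S) [s] (by simpa using hl s (by simp))
    have h2 := wordLength_prod_le (S := S) l fun t ht => hl t (by simp [ht])
    have h3 := wordLength_mul_le hS s l.prod
    simp only [List.prod_cons, List.length_cons, List.prod_nil, mul_one, List.length_nil] at *
    refine ⟨s, hl s (by simp), by omega, ?_⟩
    rw [divL_mul_iff]
    omega

theorem mem_intervalL {v w : W} : v ∈ intervalL S w ↔ DivL S v w :=
  ⟨fun h => h.2, fun h => ⟨one_divL v, h⟩⟩

theorem mem_intervalR {v w : W} : v ∈ intervalR S w ↔ DivR S v w :=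
  ⟨fun h => h.2, fun h => ⟨by simp [DivR, wordLength_one], h⟩⟩

theorem intervalL_of_divL (hS : Submonoid.closure S = ⊤) {v t w : W} (hv : DivL S v t)
    (ht : t ∈ intervalL S w) : v ∈ intervalL S w :=
  mem_intervalL.2 (hv.trans hS (mem_intervalL.1 ht))

/-- By balance `v u` is a suffix of `w`, hence so is its suffix `u`; by balance again `u` is a
prefix. This closure under suffixes is what permits left cancellation inside the interval. -/
theorem IsBalanced.right_factor_mem (hS : Submonoid.closure S = ⊤) {w v u : W}
    (hbal : IsBalanced S w) (h : DivL S v (v * u)) (ht : v * u ∈ intervalL S w) :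
    u ∈ intervalL S w := by
  rw [hbal, mem_intervalR, DivR] at ht ⊢
  rw [divL_mul_iff] at h
  have h1 := wordLength_mul_le hS (w * (v * u)⁻¹) v
  have h2 := wordLength_mul_le hS (w * u⁻¹) u
  have e1 : w * (v * u)⁻¹ * v = w * u⁻¹ := by group
  have e2 : w * u⁻¹ * u = w := by group
  rw [e1] at h1
  rw [e2] at h2
  omega

/-- In a balanced interval, joins of generators give all joins. -/
theorem IsBalanced.exists_join (hS : Submonoid.closure S = ⊤) {w : W} (hbal : IsBalanced S w)
    (hloc : ∀ s ∈ S, ∀ t ∈ S, ∃ m ∈ intervalL S w, DivL S s m ∧ DivL S t m ∧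
      ∀ e ∈ intervalL S w, DivL S s e → DivL S t e → DivL S m e)
    (a b : intervalL S w) :
    ∃ m, IsLcmFor (fun x y : intervalL S w => DivL S (x : W) y) a b m := by
  refine exists_lcm_of_local (fun x y : intervalL S w => DivL S (x : W) y)
    (fun a => DivL.refl _) (fun a b c h h' => h.trans hS h')
    (fun a => wordLength S (a : W)) (wordLength S w)
    (fun a => (mem_intervalL.1 a.2).wordLength_le) (fun a b h => h.wordLength_le)
    -- Length one makes the rank increase strictly; an abstract `S` could contain 1.
    (fun z a => ∃ s ∈ S, wordLength S s = 1 ∧ (a : W) = z * s ∧ DivL S (z : W) a)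
    ?_ ?_ ?_ ⟨1, one_mem_intervalL S w⟩ a b (one_divL _) (one_divL _)
  · rintro z ⟨_, ha⟩ ⟨s, -, hs, rfl, h⟩
    have := divL_mul_iff.1 h
    simp only
    omega
  · rintro z ⟨a, ha⟩ hza hne
    have h1 : (z : W)⁻¹ * a ≠ 1 := fun h => hne (Subtype.ext (inv_mul_eq_one.1 h))
    obtain ⟨s, hs, hs1, hsd⟩ := exists_generator_divL hS h1
    have h2 : DivL S (z : W) (z * ((z : W)⁻¹ * a)) := by simpa using hza
    obtain ⟨h3, h4⟩ := h2.mul_left hS hsd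
    rw [mul_inv_cancel_left] at h4
    exact ⟨⟨z * s, intervalL_of_divL hS h4 ha⟩, ⟨s, hs, hs1, rfl, h3⟩, h4⟩
  · rintro z ⟨_, ha⟩ ⟨_, hb⟩ ⟨s, hs, -, rfl, hzs⟩ ⟨t, ht, -, rfl, hzt⟩
    obtain ⟨m, hm, hsm, htm, hmin⟩ := hloc s hs t ht
    -- Cancelling `z` from a common upper bound `z e'` leaves `e'` in the interval and above `s` and
    -- `t`, hence above their join `m`. The case where the upper bound is `w` shows that `z m` stays
    -- in the interval.
    have lift : ∀ e, e ∈ intervalL S w → DivL S (z * s : W) e → DivL S (z * t : W) e →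
        DivL S (z : W) (z * m) ∧ DivL S (z * m : W) e := by
      intro e he hse hte
      obtain ⟨e, rfl⟩ : ∃ e', e = (z : W) * e' := ⟨(z : W)⁻¹ * e, by simp⟩
      obtain ⟨h1, h2⟩ := hzs.of_mul_left hS hse
      obtain ⟨-, h3⟩ := hzt.of_mul_left hS hte
      exact h1.mul_left hS (hmin e (hbal.right_factor_mem hS h1 he) h2 h3)
    obtain ⟨h1, h2⟩ := lift w (self_mem_intervalL S w) (mem_intervalL.1 ha) (mem_intervalL.1 hb)
    refine ⟨⟨z * m, mem_intervalL.2 h2⟩, (h1.mul_left hS hsm).2, (h1.mul_left hS htm).2, ?_⟩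
    exact fun e hse hte => (lift e e.2 hse hte).2

end WordLength

/-! ### Complements in an interval with joins -/

section Complement

variable {W : Type*} [Group W] {S : Set W} {w : W}

/-- A balanced interval with joins. -/
structure IsJoinInterval (S : Set W) (w : W) : Prop where
  closure_eq : Submonoid.closure S = ⊤
  balanced : IsBalanced S w
  exists_join : ∀ a b : intervalL S w,
    ∃ m, IsLcmFor (fun x y : intervalL S w => DivL S (x : W) y) a b m

namespace IsJoinInterval

variable (h : IsJoinInterval S w)

/-- The join of two elements of the interval. -/
noncomputable def join (a b : intervalL S w) : intervalL S w := (h.exists_join a b).choose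

theorem left_divL_join (a b : intervalL S w) : DivL S (a : W) (h.join a b) :=
  (h.exists_join a b).choose_spec.1

theorem right_divL_join (a b : intervalL S w) : DivL S (b : W) (h.join a b) :=
  (h.exists_join a b).choose_spec.2.1

theorem join_divL {a b e : intervalL S w} (ha : DivL S (a : W) e) (hb : DivL S (b : W) e) :
    DivL S (h.join a b : W) e :=
  (h.exists_join a b).choose_spec.2.2 e ha hb

include h in
theorem ext_divL {a b : intervalL S w} (hab : DivL S (a : W) b) (hba : DivL S (b : W) a) :
    a = b :=
  Subtype.ext (hab.antisymm h.closure_eq hba)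

theorem join_comm (a b : intervalL S w) : h.join a b = h.join b a :=
  h.ext_divL (h.join_divL (h.right_divL_join _ _) (h.left_divL_join _ _))
    (h.join_divL (h.right_divL_join _ _) (h.left_divL_join _ _))

/-- The complement `v \ s`, for which `v * (v \ s)` is the join of `v` and `s`. -/
noncomputable def compl (v s : intervalL S w) : intervalL S w :=
  ⟨(v : W)⁻¹ * h.join v s, h.balanced.right_factor_mem h.closure_eq (v := (v : W))
    (by simpa using h.left_divL_join v s) (by simp)⟩

theorem mul_compl (v s : intervalL S w) : (v : W) * h.compl v s = h.join v s := by
  simp [compl]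

theorem divL_mul_compl (v s : intervalL S w) : DivL S (v : W) (v * h.compl v s) := by
  rw [mul_compl]
  exact h.left_divL_join v s

/-- Every upper bound of `v u` and `s` has prefix `v`, and cancelling `v` turns it into an upper
bound of `u` and `v \ s`; conversely, multiply by `v`. This is the pasting of two join squares, from
which both complement identities follow. -/
theorem join_eq_of_mul {v u t : intervalL S w} (ht : (v : W) * u = t) (hvt : DivL S (v : W) t)
    (s : intervalL S w) : (h.join t s : W) = v * h.join u (h.compl v s) := by
  have hvR := hvt.trans h.closure_eq (h.left_divL_join t s)
  obtain ⟨r, hr⟩ : ∃ r, (h.join t s : W) = v * r := ⟨(v : W)⁻¹ * h.join t s, by simp⟩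
  have hrP : r ∈ intervalL S w := h.balanced.right_factor_mem h.closure_eq (hr ▸ hvR)
    (hr ▸ (h.join t s).2)
  have hur : DivL S (u : W) r := (DivL.of_mul_left h.closure_eq (v := (v : W)) (ht ▸ hvt)
    (by rw [ht, ← hr]; exact h.left_divL_join t s)).2
  have hcr : DivL S (h.compl v s : W) r := (DivL.of_mul_left h.closure_eq (h.divL_mul_compl v s)
    (by rw [mul_compl, ← hr]; exact h.join_divL hvR (h.right_divL_join t s))).2
  have hjr : DivL S (h.join u (h.compl v s) : W) r := h.join_divL (e := ⟨r, hrP⟩) hur hcr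
  obtain ⟨h1, h2⟩ := DivL.mul_left h.closure_eq (v := (v : W)) (hr ▸ hvR) hjr
  rw [← hr] at h2
  refine DivL.antisymm h.closure_eq ?_ h2
  refine h.join_divL (e := ⟨_, intervalL_of_divL h.closure_eq h2 (h.join t s).2⟩) ?_ ?_
  · rw [← ht]
    exact (h1.mul_left h.closure_eq (h.left_divL_join _ _)).2
  · refine (h.right_divL_join v s).trans h.closure_eq ?_
    rw [← mul_compl]
    exact (h1.mul_left h.closure_eq (h.right_divL_join _ _)).2

/-- `(v u) \ s = u \ (v \ s)`. -/
theorem compl_of_mul {v u t : intervalL S w} (ht : (v : W) * u = t) (hvt : DivL S (v : W) t)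
    (s : intervalL S w) : h.compl t s = h.compl u (h.compl v s) := by
  apply Subtype.ext
  change (t : W)⁻¹ * _ = (u : W)⁻¹ * _
  rw [h.join_eq_of_mul ht hvt, ← ht]
  group

/-- `s \ (v u) = (s \ v) ((v \ s) \ u)`. -/
theorem compl_mul {v u t : intervalL S w} (ht : (v : W) * u = t) (hvt : DivL S (v : W) t)
    (s : intervalL S w) :
    (h.compl s v : W) * h.compl (h.compl v s) u = h.compl s t := by
  change _ * ((h.compl v s : W)⁻¹ * _) = (s : W)⁻¹ * _
  rw [h.join_comm (h.compl v s) u, h.join_comm s t, h.join_eq_of_mul ht hvt]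
  change (s : W)⁻¹ * _ * (((v : W)⁻¹ * _)⁻¹ * _) = _
  rw [h.join_comm s v]
  group

/-- Supplies the additivity of lengths that makes `compl_mul` a defining relation of the interval
monoid. -/
theorem divL_compl {v t : intervalL S w} (hvt : DivL S (v : W) t) (s : intervalL S w) :
    DivL S (h.compl s v : W) (h.compl s t) := by
  refine (DivL.of_mul_left h.closure_eq (v := (s : W)) (h.divL_mul_compl s v) ?_).2
  rw [mul_compl, mul_compl]
  exact h.join_divL (h.left_divL_join s t) (hvt.trans h.closure_eq (h.right_divL_join s t))

end IsJoinInterval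

end Complement

/-! ### The interval monoid -/

section IntervalMonoid

variable {W : Type*} [Group W] {S : Set W} {w : W}

theorem intervalGen_mul {v u t : intervalL S w} (ht : (v : W) * u = t)
    (hvt : DivL S (v : W) t) : intervalGen S w v * intervalGen S w u = intervalGen S w t := by
  refine PresentedMonoid.mk_eq_mk_of_rel (.mul v u t ht ?_)
  rw [← ht, divL_mul_iff] at hvt
  rw [← ht, hvt]

theorem intervalGen_one : intervalGen S w ⟨1, one_mem_intervalL S w⟩ = 1 :=
  PresentedMonoid.mk_eq_mk_of_rel .one

theorem intervalMonoid_induction {p : IntervalMonoid S w → Prop} (one : p 1)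
    (gen_mul : ∀ v a, p a → p (intervalGen S w v * a)) (a : IntervalMonoid S w) : p a := by
  induction a using PresentedMonoid.inductionOn with
  | _ a =>
    induction a using FreeMonoid.inductionOn' with
    | one => exact one
    | of_mul v a ih => exact gen_mul v _ ih

/-- Homomorphisms out of the interval monoid. -/
def intervalLift {N : Type*} [Monoid N] (f : intervalL S w → N)
    (one : f ⟨1, one_mem_intervalL S w⟩ = 1)
    (mul : ∀ v u t : intervalL S w, (v : W) * u = t → DivL S (v : W) t → f v * f u = f t) :
    IntervalMonoid S w →* N :=
  PresentedMonoid.lift f (by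
    rintro _ _ (⟨v, u, t, ht, hl⟩ | _)
    · simpa using mul v u t ht ⟨u, ht.symm, hl.symm⟩
    · simpa using one)

variable (S w) in
/-- The projection of the interval monoid to the group. -/
def intervalProj : IntervalMonoid S w →* W := intervalLift (fun v => v) rfl
  fun _ _ _ h _ => h

@[simp]
theorem intervalProj_gen (v : intervalL S w) : intervalProj S w (intervalGen S w v) = v := rfl

theorem intervalGen_injective : Function.Injective (intervalGen S w) := fun _ _ h =>
  Subtype.ext (congrArg (intervalProj S w) h)

variable (S w) in
/-- The length on the interval monoid. -/
noncomputable def intervalLength : IntervalMonoid S w →* Multiplicative ℕ :=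
  intervalLift (fun v => Multiplicative.ofAdd (wordLength S (v : W))) (by simp [wordLength_one])
    fun _ _ _ ht hvt => by
      rw [← ht, divL_mul_iff] at hvt
      rw [← ofAdd_add, ← ht, hvt]

variable (S w) in
/-- The length on the interval monoid, as a natural number. -/
noncomputable def intervalDeg (a : IntervalMonoid S w) : ℕ := (intervalLength S w a).toAdd

theorem intervalDeg_mul (a b : IntervalMonoid S w) :
    intervalDeg S w (a * b) = intervalDeg S w a + intervalDeg S w b := by
  simp [intervalDeg]

@[simp]
theorem intervalDeg_one : intervalDeg S w 1 = 0 := by simp [intervalDeg]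

@[simp]
theorem intervalDeg_gen (v : intervalL S w) :
    intervalDeg S w (intervalGen S w v) = wordLength S (v : W) := rfl

theorem eq_one_of_intervalDeg_eq_zero (hS : Submonoid.closure S = ⊤) {a : IntervalMonoid S w}
    (ha : intervalDeg S w a = 0) : a = 1 := by
  induction a using intervalMonoid_induction with
  | one => rfl
  | gen_mul v a ih =>
    rw [intervalDeg_mul, intervalDeg_gen] at ha
    have hv : v = ⟨1, one_mem_intervalL S w⟩ :=
      Subtype.ext (wordLength_eq_zero hS (by omega))
    rw [ih (by omega), hv, intervalGen_one, one_mul]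

theorem wordLength_intervalProj_le (hS : Submonoid.closure S = ⊤) (a : IntervalMonoid S w) :
    wordLength S (intervalProj S w a) ≤ intervalDeg S w a := by
  induction a using intervalMonoid_induction with
  | one => simp [wordLength_one]
  | gen_mul v a ih =>
    rw [map_mul, intervalDeg_mul, intervalDeg_gen, intervalProj_gen]
    exact (wordLength_mul_le hS _ _).trans (by omega)

/-- An element whose length is that of its image in the interval is a simple. -/
theorem eq_intervalGen_of_wordLength_eq (hS : Submonoid.closure S = ⊤)
    (hbal : IsBalanced S w) {a : IntervalMonoid S w}
    (h : wordLength S (intervalProj S w a) = intervalDeg S w a)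
    (hmem : intervalProj S w a ∈ intervalL S w) : intervalGen S w ⟨_, hmem⟩ = a := by
  induction a using intervalMonoid_induction with
  | one => exact intervalGen_one
  | gen_mul v a ih =>
    have h1 := wordLength_mul_le hS (v : W) (intervalProj S w a)
    have h2 := wordLength_intervalProj_le hS a
    have e : intervalProj S w (intervalGen S w v * a) = v * intervalProj S w a := by simp
    rw [intervalDeg_mul, intervalDeg_gen, e] at h
    have hd : DivL S (v : W) (v * intervalProj S w a) := divL_mul_iff.2 (by omega)
    have hm := hbal.right_factor_mem hS hd (e ▸ hmem)
    rw [← intervalGen_mul (v := v) (u := ⟨_, hm⟩) (by simp) (by simpa using hd),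
      ih (by omega) hm]

theorem intervalProj_intervalTop : intervalProj S w (intervalTop S w) = w := rfl

/-- The degree of the top is `ℓ(w)`, while the degrees of `a` and `b` bound the lengths of their
images. Subadditivity therefore forces degree and length to agree for each factor, and elements with
this property over the interval are simples. -/
theorem simple_of_mul_eq_top (hS : Submonoid.closure S = ⊤) (hbal : IsBalanced S w)
    {a b : IntervalMonoid S w} (hab : a * b = intervalTop S w) :
    a ∈ Set.range (intervalGen S w) ∧ b ∈ Set.range (intervalGen S w) := by
  have h1 := wordLength_intervalProj_le hS a
  have h2 := wordLength_intervalProj_le hS b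
  have h3 := congrArg (intervalProj S w) hab
  rw [map_mul, intervalProj_intervalTop] at h3
  have h4 := congrArg (intervalDeg S w) hab
  rw [intervalDeg_mul, intervalTop, intervalDeg_gen] at h4
  have h5 := wordLength_mul_le hS (intervalProj S w a) (intervalProj S w b)
  rw [h3] at h5
  simp only at h4
  have hd : DivL S (intervalProj S w a) (intervalProj S w a * intervalProj S w b) :=
    divL_mul_iff.2 (by rw [h3]; omega)
  have hw : intervalProj S w a * intervalProj S w b ∈ intervalL S w :=
    mem_intervalL.2 (by rw [h3]; exact DivL.refl w)
  exact ⟨⟨_, eq_intervalGen_of_wordLength_eq hS hbal (by omega)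
      (intervalL_of_divL hS hd hw)⟩,
    ⟨_, eq_intervalGen_of_wordLength_eq hS hbal (by omega) (hbal.right_factor_mem hS hd hw)⟩⟩

theorem leftDivides_intervalTop_iff (hS : Submonoid.closure S = ⊤) (hbal : IsBalanced S w)
    (a : IntervalMonoid S w) :
    LeftDivides a (intervalTop S w) ↔ a ∈ Set.range (intervalGen S w) := by
  constructor
  · rintro ⟨b, hb⟩
    exact (simple_of_mul_eq_top hS hbal hb).1
  · rintro ⟨v, rfl⟩
    have hv : DivL S (v : W) (v * ((v : W)⁻¹ * w)) := by simpa using mem_intervalL.1 v.2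
    refine ⟨intervalGen S w ⟨(v : W)⁻¹ * w, hbal.right_factor_mem hS hv
      (by simpa using self_mem_intervalL S w)⟩, intervalGen_mul (by simp) ?_⟩
    simpa using mem_intervalL.1 v.2

theorem rightDivides_intervalTop_iff (hS : Submonoid.closure S = ⊤) (hbal : IsBalanced S w)
    (a : IntervalMonoid S w) :
    RightDivides a (intervalTop S w) ↔ a ∈ Set.range (intervalGen S w) := by
  constructor
  · rintro ⟨b, hb⟩
    exact (simple_of_mul_eq_top hS hbal hb).2
  · rintro ⟨v, rfl⟩
    have hv : DivR S (v : W) w := mem_intervalR.1 (hbal ▸ v.2)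
    have hd : DivL S (w * (v : W)⁻¹) w := ⟨v, by simp, hv.symm⟩
    exact ⟨intervalGen S w ⟨w * (v : W)⁻¹, mem_intervalL.2 hd⟩, intervalGen_mul (by simp) hd⟩

/-! ### Complements extended to the monoid: left cancellation and lcms. -/

namespace IsJoinInterval

variable (h : IsJoinInterval S w)

include h in
theorem compl_self (v : intervalL S w) : h.compl v v = ⟨1, one_mem_intervalL S w⟩ := by
  have e : h.join v v = v :=
    h.ext_divL (h.join_divL (DivL.refl _) (DivL.refl _)) (h.left_divL_join v v)
  apply Subtype.ext
  change (v : W)⁻¹ * _ = 1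
  rw [e, inv_mul_cancel]

theorem compl_one (v : intervalL S w) :
    h.compl v ⟨1, one_mem_intervalL S w⟩ = ⟨1, one_mem_intervalL S w⟩ := by
  have e : h.join v ⟨1, one_mem_intervalL S w⟩ = v :=
    h.ext_divL (h.join_divL (DivL.refl _) (one_divL _)) (h.left_divL_join v _)
  apply Subtype.ext
  change (v : W)⁻¹ * _ = 1
  rw [e, inv_mul_cancel]

theorem one_compl (v : intervalL S w) : h.compl ⟨1, one_mem_intervalL S w⟩ v = v := by
  have e : h.join ⟨1, one_mem_intervalL S w⟩ v = v :=
    h.ext_divL (h.join_divL (one_divL _) (DivL.refl _)) (h.right_divL_join _ _)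
  apply Subtype.ext
  change (1 : W)⁻¹ * _ = _
  rw [e, inv_one, one_mul]

theorem gen_mul_gen_compl (v s : intervalL S w) :
    intervalGen S w v * intervalGen S w (h.compl v s) = intervalGen S w (h.join v s) :=
  intervalGen_mul (h.mul_compl v s) (h.left_divL_join v s)

/-- The action of the interval monoid by complements: a generator `v` sends `(s, m)` to
`(v \ s, m (s \ v))`. -/
noncomputable def transducer :
    -- The opposite monoid appears because the first letter of a word acts first.
    IntervalMonoid S w →* (Function.End (intervalL S w × IntervalMonoid S w))ᵐᵒᵖ :=
  intervalLift (fun v => MulOpposite.op fun p =>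
      (h.compl v p.1, p.2 * intervalGen S w (h.compl p.1 v)))
    (by
      apply MulOpposite.unop_injective
      funext ⟨s, m⟩
      simp only [h.one_compl, h.compl_one, intervalGen_one, mul_one]
      rfl)
    (fun v u t ht hvt => by
      apply MulOpposite.unop_injective
      funext ⟨s, m⟩
      change (h.compl u (h.compl v s), m * intervalGen S w (h.compl s v) *
        intervalGen S w (h.compl (h.compl v s) u)) = (h.compl t s, m * intervalGen S w (h.compl s t))
      rw [h.compl_of_mul ht hvt, mul_assoc,
        intervalGen_mul (h.compl_mul ht hvt s) (h.divL_compl hvt s)])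

/-- `a \ s`, for `a` in the monoid and a simple `s`. -/
noncomputable def rem (a : IntervalMonoid S w) (s : intervalL S w) : intervalL S w :=
  ((h.transducer a).unop (s, 1)).1

/-- `s \ a`, for `a` in the monoid and a simple `s`. -/
noncomputable def quo (s : intervalL S w) (a : IntervalMonoid S w) : IntervalMonoid S w :=
  ((h.transducer a).unop (s, 1)).2

/-- The second coordinate only accumulates output on its right and never influences the action. -/
theorem transducer_apply (a : IntervalMonoid S w) (s : intervalL S w) (m : IntervalMonoid S w) :
    (h.transducer a).unop (s, m) = (h.rem a s, m * h.quo s a) := by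
  unfold rem quo
  induction a using intervalMonoid_induction generalizing s m with
  | one =>
    rw [map_one]
    exact congrArg (Prod.mk s) (mul_one m).symm
  | gen_mul v a ih =>
    simp only [map_mul, MulOpposite.unop_mul]
    change (h.transducer a).unop (h.compl v s, m * intervalGen S w (h.compl s v)) =
      (((h.transducer a).unop (h.compl v s, 1 * intervalGen S w (h.compl s v))).1,
        m * ((h.transducer a).unop (h.compl v s, 1 * intervalGen S w (h.compl s v))).2)
    rw [ih _ (m * _), ih _ (1 * _)]
    simp [mul_assoc]

theorem transducer_mul_apply (a b : IntervalMonoid S w) (s : intervalL S w) :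
    (h.rem (a * b) s, h.quo s (a * b)) = (h.rem b (h.rem a s), h.quo s a * h.quo (h.rem a s) b) := by
  have e := h.transducer_apply (a * b) s 1
  rw [one_mul] at e
  rw [← e, map_mul, MulOpposite.unop_mul]
  change (h.transducer b).unop ((h.transducer a).unop (s, 1)) = _
  rw [h.transducer_apply a, h.transducer_apply b, one_mul]

theorem rem_mul (a b : IntervalMonoid S w) (s : intervalL S w) :
    h.rem (a * b) s = h.rem b (h.rem a s) :=
  (Prod.mk.inj (h.transducer_mul_apply a b s)).1

theorem quo_mul (a b : IntervalMonoid S w) (s : intervalL S w) :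
    h.quo s (a * b) = h.quo s a * h.quo (h.rem a s) b :=
  (Prod.mk.inj (h.transducer_mul_apply a b s)).2

theorem rem_gen (v s : intervalL S w) : h.rem (intervalGen S w v) s = h.compl v s := rfl

theorem quo_gen (v s : intervalL S w) :
    h.quo s (intervalGen S w v) = intervalGen S w (h.compl s v) := one_mul _

@[simp]
theorem rem_one (s : intervalL S w) : h.rem 1 s = s := rfl

@[simp]
theorem quo_one (s : intervalL S w) : h.quo s 1 = 1 := rfl

/-- Join squares of simples, pasted along a word for `a`, form one commuting rectangle; both sides
are its diagonal. -/
theorem gen_mul_quo (s : intervalL S w) (a : IntervalMonoid S w) :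
    intervalGen S w s * h.quo s a = a * intervalGen S w (h.rem a s) := by
  induction a using intervalMonoid_induction generalizing s with
  | one => simp
  | gen_mul v a ih =>
    rw [quo_mul, rem_mul, rem_gen, quo_gen, ← mul_assoc, gen_mul_gen_compl, h.join_comm,
      ← gen_mul_gen_compl, mul_assoc, ih, mul_assoc]

theorem one_quo (a : IntervalMonoid S w) : h.quo ⟨1, one_mem_intervalL S w⟩ a = a := by
  induction a using intervalMonoid_induction with
  | one => simp
  | gen_mul v a ih => rw [quo_mul, quo_gen, rem_gen, h.one_compl, h.compl_one, ih]

/-- Reading `s` leaves the remainder `s \ s = 1`, which passes the rest of the word through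
unchanged. Thus `s \ ·` is a left inverse of multiplication by `s`. -/
theorem quo_gen_mul (s : intervalL S w) (a : IntervalMonoid S w) :
    h.quo s (intervalGen S w s * a) = a := by
  rw [quo_mul, quo_gen, rem_gen, compl_self, intervalGen_one, one_mul, one_quo]

include h

theorem mul_left_cancel {a b c : IntervalMonoid S w} (e : a * b = a * c) : b = c := by
  induction a using intervalMonoid_induction with
  | one => simpa using e
  | gen_mul s a ih =>
    refine ih ?_
    rw [mul_assoc, mul_assoc] at e
    rw [← h.quo_gen_mul s (a * b), e, h.quo_gen_mul]

/-- The lcm of `s a` and `b` is `s` times the lcm of `a` and `s \ b`: applying `s \ ·` to a multiple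
`b y = s a x` shows that `s \ b` divides `a x`. -/
theorem exists_left_lcm (a b : IntervalMonoid S w) : ∃ m, IsLcmFor LeftDivides a b m := by
  induction a using intervalMonoid_induction generalizing b with
  | one => exact ⟨b, ⟨b, one_mul b⟩, ⟨1, mul_one b⟩, fun e _ he => he⟩
  | gen_mul s a ih =>
    obtain ⟨m, ⟨a', ha⟩, ⟨b', hb⟩, hm⟩ := ih (h.quo s b)
    refine ⟨intervalGen S w s * m, ⟨a', by rw [mul_assoc, ha]⟩, 
      ⟨intervalGen S w (h.rem b s) * b', ?_⟩, ?_⟩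
    · rw [← mul_assoc, ← gen_mul_quo, mul_assoc, hb]
    · rintro e ⟨x, rfl⟩ ⟨y, hy⟩
      have hxy : h.quo s b * h.quo (h.rem b s) y = a * x := by
        rw [← h.quo_mul, hy, mul_assoc, h.quo_gen_mul]
      obtain ⟨z, hz⟩ := hm (a * x) ⟨x, rfl⟩ ⟨_, hxy⟩
      exact ⟨z, by rw [mul_assoc, hz, mul_assoc]⟩

end IsJoinInterval

end IntervalMonoid

/-! ### Intervals with an anti-automorphism -/

section AntiAutomorphism

variable {W : Type*} [Group W] {S : Set W} {w : W}

/-- An involutive anti-automorphism of the group that preserves the length and fixes `w`. -/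
structure IsIntervalReversal (S : Set W) (w : W) (φ : W → W) : Prop where
  map_mul : ∀ a b, φ (a * b) = φ b * φ a
  involutive : Function.Involutive φ
  wordLength_map : ∀ a, wordLength S (φ a) = wordLength S a
  map_top : φ w = w

namespace IsIntervalReversal

variable {φ : W → W} (hφ : IsIntervalReversal S w φ)

include hφ

theorem map_one : φ 1 = 1 := by
  have h := hφ.map_mul 1 1
  rw [mul_one] at h
  exact mul_eq_left.1 h.symm

theorem map_inv (a : W) : φ a⁻¹ = (φ a)⁻¹ := by
  rw [eq_inv_iff_mul_eq_one, ← hφ.map_mul, mul_inv_cancel, hφ.map_one]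

theorem divR_iff {v t : W} : DivR S v t ↔ DivL S (φ v) (φ t) := by
  rw [divL_iff, DivR, ← hφ.map_inv, ← hφ.map_mul, hφ.wordLength_map, hφ.wordLength_map,
    hφ.wordLength_map, add_comm, eq_comm]

theorem mem_intervalR_iff {v : W} : v ∈ intervalR S w ↔ φ v ∈ intervalL S w := by
  rw [mem_intervalR, mem_intervalL, hφ.divR_iff, hφ.map_top]

theorem map_mem (hbal : IsBalanced S w) {v : W} (hv : v ∈ intervalL S w) :
    φ v ∈ intervalL S w := by
  rw [← hφ.mem_intervalR_iff, ← hbal]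
  exact hv

/-- The anti-endomorphism of the interval monoid induced by `φ`. -/
def monoidMap (hbal : IsBalanced S w) : IntervalMonoid S w →* (IntervalMonoid S w)ᵐᵒᵖ :=
  intervalLift (fun v => MulOpposite.op (intervalGen S w ⟨φ v, hφ.map_mem hbal v.2⟩))
    (by simp only [hφ.map_one, intervalGen_one, MulOpposite.op_one])
    (fun v u t ht hvt => by
      rw [← MulOpposite.op_mul]
      congr 1
      refine intervalGen_mul ?_ ⟨φ v, ?_, ?_⟩
      · simp only [← hφ.map_mul, ht]
      · simp only [← hφ.map_mul, ht]
      · simp only [hφ.wordLength_map]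
        rw [← ht, divL_mul_iff] at hvt
        rw [← ht, hvt, add_comm])

theorem exists_reversal (hbal : IsBalanced S w) :
    ∃ ψ : IntervalMonoid S w → IntervalMonoid S w,
      (∀ a b, ψ (a * b) = ψ b * ψ a) ∧ Function.Involutive ψ := by
  refine ⟨fun a => (hφ.monoidMap hbal a).unop, fun a b => by simp, fun a => ?_⟩
  induction a using intervalMonoid_induction with
  | one => simp
  | gen_mul v a ih =>
    have hv : (hφ.monoidMap hbal (hφ.monoidMap hbal (intervalGen S w v)).unop).unop =
        intervalGen S w v := congrArg (intervalGen S w) (Subtype.ext (hφ.involutive v))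
    simp only [_root_.map_mul, MulOpposite.unop_mul] at ih ⊢
    rw [hv, ih]

end IsIntervalReversal

theorem rightDivides_iff_of_reversal {M : Type*} [Monoid M] {ψ : M → M}
    (hmul : ∀ a b, ψ (a * b) = ψ b * ψ a) (hinv : Function.Involutive ψ) (a b : M) :
    RightDivides a b ↔ LeftDivides (ψ a) (ψ b) := by
  constructor
  · rintro ⟨c, rfl⟩
    exact ⟨ψ c, (hmul c a).symm⟩
  · rintro ⟨c, hc⟩
    refine ⟨ψ c, ?_⟩
    rw [← hinv a, ← hmul, hc, hinv]

theorem IsLcmFor.of_equiv {A B : Type*} {r : A → A → Prop} {r' : B → B → Prop} {f : A → B}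
    (hf : Function.Surjective f) (hr : ∀ a b, r a b ↔ r' (f a) (f b)) {a b : A} {m : B}
    (h : IsLcmFor r' (f a) (f b) m) : ∃ m, IsLcmFor r a b m := by
  obtain ⟨m, rfl⟩ := hf m
  exact ⟨m, (hr _ _).2 h.1, (hr _ _).2 h.2.1,
    fun e ha hb => (hr _ _).2 (h.2.2 _ ((hr _ _).1 ha) ((hr _ _).1 hb))⟩

/-- A balanced interval with joins and an anti-automorphism gives an interval Garside monoid. -/
theorem IsJoinInterval.isIntervalGarsideMonoid (h : IsJoinInterval S w) {φ : W → W}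
    (hφ : IsIntervalReversal S w φ) : IsIntervalGarsideMonoid S w := by
  have hS := h.closure_eq
  have hbal := h.balanced
  obtain ⟨ψ, hψ, hψ'⟩ := hφ.exists_reversal hbal
  have hψ1 := rightDivides_iff_of_reversal hψ hψ'
  have hlcmR : ∀ f g : IntervalMonoid S w, ∃ m, IsLcmFor RightDivides f g m := fun f g => by
    obtain ⟨m, hm⟩ := h.exists_left_lcm (ψ f) (ψ g)
    exact hm.of_equiv hψ'.surjective hψ1
  have hrefl : ∀ v : W, DivR S v v := fun v => hφ.divR_iff.2 (DivL.refl _)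
  have hsupR : ∀ a b : intervalR S w,
      ∃ m, IsLcmFor (fun x y : intervalR S w => DivR S (x : W) y) a b m := fun a b => by
    obtain ⟨m, hm⟩ := h.exists_join ⟨φ a, hφ.mem_intervalR_iff.1 a.2⟩
      ⟨φ b, hφ.mem_intervalR_iff.1 b.2⟩
    refine IsLcmFor.of_equiv (f := fun v : intervalR S w =>
      (⟨φ v, hφ.mem_intervalR_iff.1 v.2⟩ : intervalL S w)) ?_ (fun _ _ => hφ.divR_iff) hm
    exact fun v => ⟨⟨φ v, hφ.mem_intervalR_iff.2 (by rw [hφ.involutive]; exact v.2)⟩,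
      Subtype.ext (hφ.involutive _)⟩
  have hlen : ∀ v t : W, DivR S v t → wordLength S v ≤ wordLength S t := fun v t hvt => by
    rw [DivR] at hvt
    omega
  have hantiR : ∀ v t : W, DivR S v t → wordLength S v = wordLength S t → v = t :=
    fun v t hvt he => hφ.involutive.injective
      ((hφ.divR_iff.1 hvt).eq_of_wordLength_eq hS (by simpa [hφ.wordLength_map] using he))
  refine ⟨hS, hbal, ?_, ?_, ⟨⟨intervalDeg S w, fun f g => (intervalDeg_mul f g).ge,
    fun g hg h0 => hg (eq_one_of_intervalDeg_eq_zero hS h0)⟩, ?_, ?_, h.exists_left_lcm, ?_, hlcmR,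
    ?_, ?_⟩, intervalGen_injective, ?_⟩
  · refine isLatticeOn_of_exists _ _ DivL.refl (fun _ _ _ h1 h2 => h1.trans hS h2)
      (fun _ _ => DivL.antisymm hS) h.exists_join ?_
    exact exists_gcd_of_exists_lcm _ (fun v : intervalL S w => wordLength S (v : W))
      (fun _ _ => DivL.wordLength_le)
      (fun _ _ h1 h2 => Subtype.ext (h1.eq_of_wordLength_eq hS h2))
      ⟨1, one_mem_intervalL S w⟩ (fun _ => one_divL _) h.exists_join
  · refine isLatticeOn_of_exists _ _ hrefl (fun _ _ _ h1 h2 => hφ.divR_iff.2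
      ((hφ.divR_iff.1 h1).trans hS (hφ.divR_iff.1 h2)))
      (fun _ _ h1 h2 => hantiR _ _ h1 (le_antisymm (hlen _ _ h1) (hlen _ _ h2))) hsupR ?_
    refine exists_gcd_of_exists_lcm _ (fun v : intervalR S w => wordLength S (v : W))
      (fun _ _ => hlen _ _) (fun _ _ h1 h2 => Subtype.ext (hantiR _ _ h1 h2))
      ⟨1, hbal ▸ one_mem_intervalL S w⟩ (fun a => ?_) hsupR
    simp [DivR, wordLength_one]
  · intro a f g b e
    rw [mul_assoc, mul_assoc] at e
    -- Right cancellation is left cancellation after reversal.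
    have e' := congrArg ψ (h.mul_left_cancel e)
    rw [hψ, hψ] at e'
    exact hψ'.injective (h.mul_left_cancel e')
  · refine exists_gcd_of_exists_lcm _ (intervalDeg S w) ?_ ?_ 1 (fun a => ⟨a, one_mul a⟩)
      h.exists_left_lcm
    · rintro a _ ⟨b, rfl⟩
      rw [intervalDeg_mul]
      omega
    · rintro a _ ⟨b, rfl⟩ he
      rw [intervalDeg_mul] at he
      rw [eq_one_of_intervalDeg_eq_zero hS (a := b) (by omega), mul_one]
  · refine exists_gcd_of_exists_lcm _ (intervalDeg S w) ?_ ?_ 1 (fun a => ⟨a, mul_one a⟩) hlcmR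
    · rintro a _ ⟨b, rfl⟩
      rw [intervalDeg_mul]
      omega
    · rintro a _ ⟨b, rfl⟩ he
      rw [intervalDeg_mul] at he
      rw [eq_one_of_intervalDeg_eq_zero hS (a := b) (by omega), one_mul]
  · ext a
    exact (leftDivides_intervalTop_iff hS hbal a).trans
      (rightDivides_intervalTop_iff hS hbal a).symm
  · refine (Submonoid.eq_top_iff' _).2 fun a => ?_
    induction a using intervalMonoid_induction with
    | one => exact one_mem _
    | gen_mul v a ih =>
      exact mul_mem (Submonoid.subset_closure
        ((leftDivides_intervalTop_iff hS hbal _).2 ⟨v, rfl⟩)) ih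
  · ext a
    exact leftDivides_intervalTop_iff hS hbal a

end AntiAutomorphism

/-! ### Groups of fractions -/

section Fractions

universe u

/-- A cancellative monoid with common left and right multiples has a group of fractions. -/
theorem exists_isGroupOfFractions {M : Type u} [Monoid M]
    (hl : ∀ a b c : M, a * b = a * c → b = c) (hr : ∀ a b c : M, b * a = c * a → b = c)
    (hcl : ∀ a b : M, ∃ c d, a * c = b * d) (hcr : ∀ a b : M, ∃ c d, c * a = d * b) :
    ∃ (G : Type u) (_ : Group G) (ι : M →* G), IsGroupOfFractions ι := by
  choose num den hnd using hcr
  -- All elements are inverted; common left multiples give the Ore condition.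
  let _ : OreLocalization.OreSet (⊤ : Submonoid M) :=
    { ore_right_cancel := fun a b s h => ⟨1, by rw [hr _ _ _ h]⟩
      oreNum := fun r s => den r s
      oreDenom := fun r s => ⟨num r s, trivial⟩
      ore_eq := fun r s => hnd r s }
  let L := OreLocalization (⊤ : Submonoid M) M
  let ι : M →* L := OreLocalization.numeratorHom (S := ⊤)
  have hι : ∀ a, IsUnit (ι a) := fun a => 
    OreLocalization.numerator_isUnit (S := ⊤) ⟨a, trivial⟩
  have hfrac : ∀ g : L, ∃ a b : M, ι b * g = ι a := by
    intro g
    induction g using OreLocalization.ind with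
    | _ a s =>
      refine ⟨a, s, ?_⟩
      exact OreLocalization.mul_cancel (s := s) (t := 1)
  have hunit : ∀ g : L, IsUnit g := fun g => by
    obtain ⟨a, b, h⟩ := hfrac g
    have h1 := hι a
    rw [← h] at h1
    exact (hι b).mul_left_iff.1 h1
  let _ : Group L := groupOfIsUnit hunit
  have hleft : ∀ g : L, ∃ a b : M, g = (ι b)⁻¹ * ι a := fun g => by
    obtain ⟨a, b, h⟩ := hfrac g
    exact ⟨a, b, eq_inv_mul_of_mul_eq h⟩
  refine ⟨L, inferInstance, ι, ?_, ?_, hleft, ?_⟩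
  · intro a b h
    -- Equality of the fractions of `a` and `b` with denominator 1 means `u b = v a` with `u = v`,
    -- so left cancellation applies.
    obtain ⟨u, v, h1, h2⟩ := OreLocalization.oreDiv_eq_iff.1
      (show OreLocalization.oreDiv a (1 : (⊤ : Submonoid M)) = OreLocalization.oreDiv b 1 from h)
    simp only [Submonoid.coe_one, mul_one] at h2
    change (u : M) * b = v * a at h1
    rw [← h2] at h1
    exact (hl _ _ _ h1).symm
  · intro g
    obtain ⟨a, b, rfl⟩ := hleft g
    -- A common right multiple `a c = b d` turns `b⁻¹ a` into `d c⁻¹`.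
    obtain ⟨c, d, h⟩ := hcl a b
    refine ⟨d, c, ?_⟩
    rw [inv_mul_eq_iff_eq_mul, ← mul_assoc, eq_mul_inv_iff_mul_eq, ← map_mul, ← map_mul, h]
  · intro H _ f
    let fS : (⊤ : Submonoid M) →* Hˣ := (toUnits.toMonoidHom.comp f).comp (Submonoid.subtype _)
    have hf : ∀ s : (⊤ : Submonoid M), f s = fS s := fun s => rfl
    refine ⟨OreLocalization.universalMulHom f fS hf, ?_, ?_⟩
    · ext a
      exact OreLocalization.universalMulHom_commutes f fS (hf := hf)
    · intro F hF
      exact OreLocalization.universalMulHom_unique f fS hf F fun a => DFunLike.congr_fun hF a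

theorem IsGarsideMonoid.exists_isGroupOfFractions {M : Type u} [Monoid M] {Δ : M}
    (h : IsGarsideMonoid M Δ) :
    ∃ (G : Type u) (_ : Group G) (ι : M →* G), IsGroupOfFractions ι := by
  refine _root_.exists_isGroupOfFractions (fun a b c e => h.cancellative a b c 1 (by simpa using e))
    (fun a b c e => h.cancellative 1 b c a (by simpa using e)) (fun a b => ?_) (fun a b => ?_)
  · obtain ⟨m, ⟨c, hc⟩, ⟨d, hd⟩, -⟩ := h.exists_left_lcm a b
    exact ⟨c, d, hc.trans hd.symm⟩
  · obtain ⟨m, ⟨c, hc⟩, ⟨d, hd⟩, -⟩ := h.exists_right_lcm a b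
    exact ⟨c, d, hc.trans hd.symm⟩

end Fractions

/-! ### Coordinates on `G(∞,∞,n)` -/

section Coordinates

variable {K : Type*} [Field K] {n : ℕ} {x : Kˣ}

theorem monoMatrix_injective {σ τ : Equiv.Perm (Fin n)} {u v : Fin n → Kˣ}
    (h : monoMatrix σ u = monoMatrix τ v) : σ = τ ∧ u = v := by
  have hσ : σ = τ := Equiv.ext fun i => by
    have := (monoMatrix_ne_zero σ u i (σ i)).2 rfl
    rw [h, monoMatrix_ne_zero] at this
    exact this.symm
  subst hσ
  refine ⟨rfl, funext fun i => Units.ext ?_⟩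
  have := congrFun (congrFun h i) (σ i)
  simpa [monoMatrix] using this

/-- `g` is the monomial matrix with entry `x ^ a i` in row `i` and column `σ i`. -/
def HasCoords (g : GInf x n) (σ : Equiv.Perm (Fin n)) (a : Fin n → ℤ) : Prop :=
  ((g : GL (Fin n) K) : Matrix (Fin n) (Fin n) K) = monoMatrix σ fun i => x ^ a i

theorem exists_hasCoords (g : GInf x n) : ∃ σ a, HasCoords g σ a := by
  obtain ⟨σ, u, hu, -, h⟩ := (isGInfMatrix_iff x _).1 g.2
  choose a ha using hu
  exact ⟨σ, a, h.trans (congrArg _ (funext fun i => (ha i).symm))⟩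

/-- The permutation underlying an element of `G(∞,∞,n)`. -/
noncomputable def perm (g : GInf x n) : Equiv.Perm (Fin n) := (exists_hasCoords g).choose

/-- The exponents of the nonzero entries of an element of `G(∞,∞,n)`, by rows. -/
noncomputable def expo (g : GInf x n) : Fin n → ℤ := (exists_hasCoords g).choose_spec.choose

theorem hasCoords (g : GInf x n) : HasCoords g (perm g) (expo g) :=
  (exists_hasCoords g).choose_spec.choose_spec

theorem HasCoords.ext {g h : GInf x n} {σ : Equiv.Perm (Fin n)} {a : Fin n → ℤ}
    (hg : HasCoords g σ a) (hh : HasCoords h σ a) : g = h :=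
  Subtype.ext (Units.ext (hg.trans hh.symm))

theorem gInf_ext {g h : GInf x n} (h1 : perm g = perm h) (h2 : expo g = expo h) : g = h :=
  HasCoords.ext (hasCoords g) (h1 ▸ h2 ▸ hasCoords h)

theorem HasCoords.mul {g h : GInf x n} {σ τ : Equiv.Perm (Fin n)} {a b : Fin n → ℤ}
    (hg : HasCoords g σ a) (hh : HasCoords h τ b) :
    HasCoords (g * h) (τ * σ) fun i => a i + b (σ i) := by
  change ((g : GL (Fin n) K) : Matrix (Fin n) (Fin n) K) * ((h : GL (Fin n) K) : _) = _
  rw [hg, hh, monoMatrix_mul]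
  simp only [zpow_add]

theorem hasCoords_one : HasCoords (1 : GInf x n) 1 0 := by
  change (1 : Matrix (Fin n) (Fin n) K) = _
  simp [← monoMatrix_one]

theorem exists_of_coords (σ : Equiv.Perm (Fin n)) (a : Fin n → ℤ) (ha : ∑ i, a i = 0) :
    ∃ g : GInf x n, HasCoords g σ a :=
  exists_monoMatrix x σ (fun i => x ^ a i) (fun i => ⟨a i, rfl⟩)
    (by
      have : ∏ i, x ^ a i = x ^ ∑ i, a i := by
        induction (Finset.univ : Finset (Fin n)) using Finset.cons_induction with
        | empty => simp
        | cons i s hi ih => rw [Finset.prod_cons, Finset.sum_cons, zpow_add, ih]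
      rw [this, ha, zpow_zero])

theorem HasCoords.perm_eq {g : GInf x n} {σ : Equiv.Perm (Fin n)} {a : Fin n → ℤ}
    (hg : HasCoords g σ a) : perm g = σ :=
  (monoMatrix_injective ((hasCoords g).symm.trans hg)).1

/-- The order is reversed because `perm` sends a row to the column of its nonzero entry, so the left
factor acts first. -/
theorem perm_mul (g h : GInf x n) : perm (g * h) = perm h * perm g :=
  ((hasCoords g).mul (hasCoords h)).perm_eq

theorem perm_mul_apply (g h : GInf x n) (i : Fin n) : perm (g * h) i = perm h (perm g i) := by
  rw [perm_mul, Equiv.Perm.mul_apply]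

variable (hx : Function.Injective fun m : ℤ => x ^ m)

include hx

theorem HasCoords.expo_eq {g : GInf x n} {σ : Equiv.Perm (Fin n)} {a : Fin n → ℤ}
    (hg : HasCoords g σ a) : expo g = a :=
  funext fun i => hx (congrFun (monoMatrix_injective ((hasCoords g).symm.trans hg)).2 i)

theorem expo_mul (g h : GInf x n) (i : Fin n) :
    expo (g * h) i = expo g i + expo h (perm g i) :=
  congrFun (((hasCoords g).mul (hasCoords h)).expo_eq hx) i

theorem sum_expo (g : GInf x n) : ∑ i, expo g i = 0 := by
  obtain ⟨σ, u, -, hp, h⟩ := (isGInfMatrix_iff x _).1 g.2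
  have hu := (monoMatrix_injective ((hasCoords g).symm.trans h)).2
  have hsum : ∏ i, x ^ expo g i = x ^ ∑ i, expo g i := by
    induction (Finset.univ : Finset (Fin n)) using Finset.cons_induction with
    | empty => simp
    | cons i s hi ih => rw [Finset.prod_cons, Finset.sum_cons, zpow_add, ih]
  refine hx ?_
  simp only [← hsum, zpow_zero]
  rw [← hp, ← hu]

end Coordinates

/-! ### The length function in coordinates -/

section Cost

variable {K : Type*} [Field K] {n : ℕ} {x : Kˣ}

/-- Collects both orders of a pair into one term, so that sums over pairs can be reindexed by a
permutation that does not preserve order. -/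
theorem sum_sum_eq_sum_lt (F : Fin n → Fin n → ℕ) (hF : ∀ i, F i i = 0) :
    ∑ i, ∑ j, F i j = ∑ i, ∑ j, if i < j then F i j + F j i else 0 := by
  have h1 : ∀ i j, (if i < j then F i j + F j i else 0) =
      (if i < j then F i j else 0) + if i < j then F j i else 0 := fun i j => by
    split_ifs <;> rfl
  simp only [h1, Finset.sum_add_distrib]
  rw [Finset.sum_comm (f := fun i j => if i < j then F j i else 0), ← Finset.sum_add_distrib]
  refine Finset.sum_congr rfl fun i _ => ?_
  rw [← Finset.sum_add_distrib]
  refine Finset.sum_congr rfl fun j _ => ?_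
  rcases lt_trichotomy i j with h | rfl | h
  · simp [h, h.not_gt]
  · simp [hF]
  · simp [h, h.not_gt]

/-- The contribution of a pair of rows to the length. -/
noncomputable def pairCost (g : GInf x n) (i j : Fin n) : ℕ :=
  -- The value 2 corresponds to crossing twice with different exponents, as in `t_a t_b` with `a ≠
  -- b`.
  if i < j then if perm g j < perm g i then 1 else if expo g j = 0 then 0 else 2 else 0

/-- The sum of the contributions of all pairs of rows. -/
noncomputable def cost (g : GInf x n) : ℕ := ∑ i, ∑ j, pairCost g i j

/-- The contribution to the length of `u` of the pair of rows `perm v i`, `perm v j`. -/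
noncomputable def pushCost (v u : GInf x n) (i j : Fin n) : ℕ :=
  if i < j then
    pairCost u (perm v i) (perm v j) + pairCost u (perm v j) (perm v i)
  else 0

theorem sum_pushCost (v u : GInf x n) : ∑ i, ∑ j, pushCost v u i j = cost u := by
  unfold pushCost
  rw [← sum_sum_eq_sum_lt fun i j => pairCost u (perm v i) (perm v j)]
  · rw [cost, ← Equiv.sum_comp (perm v) fun i => ∑ j, pairCost u i j]
    exact Finset.sum_congr rfl fun i _ => Equiv.sum_comp (perm v) fun j => pairCost u (perm v i) j
  · simp [pairCost]

/-- On the pair of rows `i`, `j`, `w` lies above an inversion with exponent `c`. -/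
def GeInv (w : GInf x n) (i j : Fin n) (c : ℤ) : Prop :=
  (perm w i < perm w j → expo w j ≠ 0) ∧ (perm w j < perm w i → expo w i = c)

/-- The condition of the pair of rows `i`, `j` for `v` to divide `w`. -/
def PairLe (v w : GInf x n) (i j : Fin n) : Prop :=
  (perm v i < perm v j → expo v j = 0 ∨ perm w i < perm w j ∧ expo w j = expo v j) ∧
    (perm v j < perm v i → GeInv w i j (expo v i))

variable (hx : Function.Injective fun m : ℤ => x ^ m)

include hx

/-- Four cases, according to whether `v` and `v u` invert the pair. The exponent of `u` that matters
sits at the larger of `perm v i`, `perm v j`; by `expo_mul` it is the change of exponent from `v` to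
`v u` in the corresponding row. `PairLe` records exactly when no cost is lost. -/
theorem pairCost_mul (v u : GInf x n) (i j : Fin n) :
    pairCost (v * u) i j ≤ pairCost v i j + pushCost v u i j ∧
      (pairCost (v * u) i j = pairCost v i j + pushCost v u i j ↔
        (i < j → PairLe v (v * u) i j)) := by
  by_cases hij : i < j
  · have h1 : perm v i ≠ perm v j := fun h => hij.ne ((perm v).injective h)
    have h2 : perm (v * u) i ≠ perm (v * u) j := fun h => hij.ne ((perm (v * u)).injective h)
    have h3 := expo_mul hx v u i
    have h4 := expo_mul hx v u j
    simp only [pairCost, pushCost, PairLe, GeInv, hij, if_true, forall_const, ← perm_mul_apply]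
    generalize perm (v * u) i = a at *
    generalize perm (v * u) j = b at *
    generalize perm v i = c at *
    generalize perm v j = d at *
    rcases lt_or_gt_of_ne h1 with h1 | h1 <;> rcases lt_or_gt_of_ne h2 with h2 | h2 <;>
    simp only [h1, h2, h1.not_gt, h2.not_gt, if_true, if_false, forall_const, IsEmpty.forall_iff,
      true_and, and_true, false_and, or_false] <;>
    split_ifs <;> first | omega | (simp only [false_iff]; omega)
  · simp [pairCost, pushCost, hij]

theorem cost_mul_le (v u : GInf x n) : cost (v * u) ≤ cost v + cost u := by
  rw [← sum_pushCost v u]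
  simp only [cost, ← Finset.sum_add_distrib]
  exact Finset.sum_le_sum fun i _ => Finset.sum_le_sum fun j _ => (pairCost_mul hx v u i j).1

/-- A sum of termwise inequalities is an equality only if every term is, so additivity of the length
is decided one pair at a time. -/
theorem cost_mul_eq_iff (v u : GInf x n) :
    cost (v * u) = cost v + cost u ↔ ∀ i j, i < j → PairLe v (v * u) i j := by
  rw [← sum_pushCost v u]
  simp only [cost, ← Finset.sum_add_distrib]
  rw [Finset.sum_eq_sum_iff_of_le
    fun i _ => Finset.sum_le_sum fun j _ => (pairCost_mul hx v u i j).1]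
  refine forall_congr' fun i => ?_
  simp only [Finset.mem_univ, forall_const]
  rw [Finset.sum_eq_sum_iff_of_le fun j _ => (pairCost_mul hx v u i j).1]
  simp only [Finset.mem_univ, forall_const]
  exact forall_congr' fun j => (pairCost_mul hx v u i j).2

theorem cost_one : cost (1 : GInf x n) = 0 := by
  have h := (cost_mul_eq_iff hx (1 : GInf x n) 1).2 fun i j hij =>
    ⟨fun _ => Or.inl (by simp [hasCoords_one.expo_eq hx]),
      fun h => absurd h (by simpa [hasCoords_one.perm_eq] using hij.le)⟩
  rw [mul_one] at h
  omega

end Cost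

/-! ### Transposition -/

section Transpose

variable {K : Type*} [Field K] {n : ℕ} {x : Kˣ} (hx : Function.Injective fun m : ℤ => x ^ m)

include hx

theorem exists_transpose (g : GInf x n) :
    ∃ g' : GInf x n, HasCoords g' (perm g)⁻¹ fun i => expo g ((perm g)⁻¹ i) :=
  exists_of_coords _ _ (by rw [Equiv.sum_comp (perm g)⁻¹ (expo g), sum_expo hx])

/-- The transpose of an element of `G(∞,∞,n)`. -/
noncomputable def gTranspose (g : GInf x n) : GInf x n := (exists_transpose hx g).choose

theorem perm_gTranspose (g : GInf x n) : perm (gTranspose hx g) = (perm g)⁻¹ :=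
  (exists_transpose hx g).choose_spec.perm_eq

theorem expo_gTranspose (g : GInf x n) (i : Fin n) :
    expo (gTranspose hx g) i = expo g ((perm g)⁻¹ i) :=
  congrFun ((exists_transpose hx g).choose_spec.expo_eq hx) i

theorem gTranspose_mul (g h : GInf x n) :
    gTranspose hx (g * h) = gTranspose hx h * gTranspose hx g := by
  apply gInf_ext
  · simp [perm_mul, perm_gTranspose]
  · funext i
    simp [expo_mul hx, perm_mul, expo_gTranspose, perm_gTranspose, add_comm]

theorem gTranspose_involutive : Function.Involutive (gTranspose (n := n) hx) := fun g => by
  apply gInf_ext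
  · simp [perm_gTranspose]
  · funext i
    simp [expo_gTranspose, perm_gTranspose]

/-- Reindexed by `perm g`, transposition keeps the inverted pairs; in a pair in order the later row
stays later and carries the same exponent. -/
theorem cost_gTranspose (g : GInf x n) : cost (gTranspose hx g) = cost g := by
  have h : cost (gTranspose hx g) =
      ∑ i, ∑ j, pairCost (gTranspose hx g) (perm g i) (perm g j) := by
    rw [cost, ← Equiv.sum_comp (perm g) fun i => ∑ j, pairCost (gTranspose hx g) i j]
    exact Finset.sum_congr rfl fun i _ =>
      (Equiv.sum_comp (perm g) fun j => pairCost (gTranspose hx g) (perm g i) j).symm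
  rw [h, sum_sum_eq_sum_lt _ (by simp [pairCost])]
  refine Finset.sum_congr rfl fun i _ => Finset.sum_congr rfl fun j _ => ?_
  simp only [pairCost, perm_gTranspose, expo_gTranspose, Equiv.Perm.coe_inv, Equiv.symm_apply_apply]
  by_cases hij : i < j
  · rcases lt_or_gt_of_ne fun e => hij.ne ((perm g).injective e) with h | h <;>
      simp [h, hij, h.not_gt, hij.not_gt]
  · simp [hij]

end Transpose

/-! ### Generators in coordinates -/

section Generators

variable {K : Type*} [Field K] {n : ℕ} {x : Kˣ}

/-- The function with value `c` at `p`, `-c` at `q`, and `0` elsewhere. -/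
def dipole (p q : Fin n) (c : ℤ) (i : Fin n) : ℤ :=
  (if i = p then c else 0) - if i = q then c else 0

theorem sum_dipole (p q : Fin n) (c : ℤ) : ∑ i, dipole p q c i = 0 := by
  simp [dipole, Finset.sum_sub_distrib]

/-- `g` is the generator that exchanges the coordinates `p` and `p + 1`, with exponent `c`. -/
def IsElementary (g : GInf x n) (p : ℕ) (c : ℤ) : Prop :=
  ∃ hp : p + 1 < n, (p = 0 ∨ c = 0) ∧
    HasCoords g (Equiv.swap ⟨p, by omega⟩ ⟨p + 1, hp⟩) (dipole ⟨p, by omega⟩ ⟨p + 1, hp⟩ c)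

theorem tMatrix_eq_monoMatrix (x : Kˣ) (hn : 1 < n) (k : ℤ) :
    tMatrix x n k = monoMatrix (Equiv.swap (⟨0, by omega⟩ : Fin n) ⟨1, hn⟩)
      fun i => x ^ dipole (⟨0, by omega⟩ : Fin n) ⟨1, hn⟩ (-k) i := by
  ext ⟨i, hi⟩ j
  by_cases h0 : i = 0
  · subst h0
    simp only [tMatrix, monoMatrix, Matrix.of_apply, Equiv.swap_apply_left, dipole, Fin.ext_iff]
    by_cases h : j.val = 1 <;> simp [h, eq_comm]
  by_cases h1 : i = 1
  · subst h1
    simp only [tMatrix, monoMatrix, Matrix.of_apply, Equiv.swap_apply_right, dipole, Fin.ext_iff]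
    by_cases h : j.val = 0 <;> simp [h, eq_comm]
  · have e0 : (⟨i, hi⟩ : Fin n) ≠ ⟨0, by omega⟩ := fun h => h0 (congrArg Fin.val h)
    have e1 : (⟨i, hi⟩ : Fin n) ≠ ⟨1, by omega⟩ := fun h => h1 (congrArg Fin.val h)
    have e2 : 2 ≤ i := by omega
    simp [tMatrix, monoMatrix, Equiv.swap_apply_of_ne_of_ne e0 e1, dipole, e0, e1, h0, h1, e2]

theorem sMatrix_eq_monoMatrix (x : Kˣ) (p : ℕ) (hp : p + 1 < n) :
    sMatrix K n (p + 2) = monoMatrix (Equiv.swap (⟨p, by omega⟩ : Fin n) ⟨p + 1, hp⟩)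
      fun i => x ^ dipole (⟨p, by omega⟩ : Fin n) ⟨p + 1, hp⟩ 0 i := by
  ext ⟨i, hi⟩ j
  have hd : dipole (⟨p, by omega⟩ : Fin n) ⟨p + 1, hp⟩ 0 ⟨i, hi⟩ = 0 := by simp [dipole]
  simp only [sMatrix, monoMatrix, Matrix.of_apply, hd, zpow_zero, Units.val_one]
  by_cases h0 : i = p
  · subst h0
    simp only [Equiv.swap_apply_left, Fin.ext_iff, true_and]
    split_ifs <;> first | rfl | omega
  by_cases h1 : i = p + 1
  · subst h1
    simp only [Equiv.swap_apply_right, Fin.ext_iff, true_and]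
    split_ifs <;> first | rfl | omega
  · have e0 : (⟨i, hi⟩ : Fin n) ≠ ⟨p, by omega⟩ := fun h => h0 (congrArg Fin.val h)
    have e1 : (⟨i, hi⟩ : Fin n) ≠ ⟨p + 1, by omega⟩ := fun h => h1 (congrArg Fin.val h)
    rw [Equiv.swap_apply_of_ne_of_ne e0 e1]
    simp only [Fin.ext_iff]
    split_ifs <;> first | rfl | omega

theorem mem_genX_iff (hn : 2 ≤ n) (g : GInf x n) : g ∈ genX x n ↔ ∃ p c, IsElementary g p c := by
  constructor
  · rintro (⟨k, hk⟩ | ⟨j, hj, hjn, h⟩)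
    · exact ⟨0, -k, by omega, Or.inl rfl, hk.trans (tMatrix_eq_monoMatrix x (by omega) k)⟩
    · obtain ⟨p, rfl⟩ := Nat.exists_eq_add_of_le' (show 2 ≤ j by omega)
      exact ⟨p, 0, by omega, Or.inr rfl, h.trans (sMatrix_eq_monoMatrix x p (by omega))⟩
  · rintro ⟨p, c, hp, hc, h⟩
    by_cases h0 : p = 0
    · subst h0
      refine Or.inl ⟨-c, h.trans ?_⟩
      rw [tMatrix_eq_monoMatrix x (by omega), neg_neg]
    · obtain rfl : c = 0 := hc.resolve_left h0
      refine Or.inr ⟨p + 2, by omega, by omega, h.trans ?_⟩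
      rw [sMatrix_eq_monoMatrix x p hp]

theorem exists_isElementary (x : Kˣ) {p : ℕ} {c : ℤ} (hp : p + 1 < n) (hc : p = 0 ∨ c = 0) :
    ∃ g : GInf x n, IsElementary g p c :=
  let ⟨g, hg⟩ := exists_of_coords (x := x) (Equiv.swap ⟨p, by omega⟩ ⟨p + 1, hp⟩) _
    (sum_dipole ⟨p, by omega⟩ ⟨p + 1, hp⟩ c)
  ⟨g, hp, hc, hg⟩

theorem IsElementary.perm_apply {g : GInf x n} {p : ℕ} {c : ℤ} (hg : IsElementary g p c)
    (i : Fin n) :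
    (perm g i : ℕ) = if (i : ℕ) = p then p + 1 else if (i : ℕ) = p + 1 then p else i := by
  obtain ⟨hp, -, h⟩ := hg
  rw [h.perm_eq, Equiv.swap_apply_def]
  simp only [Fin.ext_iff]
  split_ifs <;> rfl

variable (hx : Function.Injective fun m : ℤ => x ^ m)

include hx

theorem IsElementary.expo_apply {g : GInf x n} {p : ℕ} {c : ℤ} (hg : IsElementary g p c)
    (i : Fin n) :
    expo g i = (if (i : ℕ) = p then c else 0) - if (i : ℕ) = p + 1 then c else 0 := by
  obtain ⟨hp, -, h⟩ := hg
  rw [h.expo_eq hx]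
  simp only [dipole, Fin.ext_iff]

theorem IsElementary.cost_eq {g : GInf x n} {p : ℕ} {c : ℤ} (hg : IsElementary g p c) :
    cost g = 1 := by
  have hp := hg.1
  have hc := hg.2.1
  have key : ∀ i j, pairCost g i j =
      if i = ⟨p, by omega⟩ then if j = ⟨p + 1, hp⟩ then 1 else 0 else 0 := by
    intro i j
    simp only [pairCost, Fin.lt_def, hg.perm_apply, hg.expo_apply hx, Fin.ext_iff]
    split_ifs <;> omega
  simp [cost, key]

/-- Only the pair `p`, `p + 1` gives a condition: it is the sole inversion of `g`, and every other
pair has lower exponent 0. The latter uses that `c` vanishes unless `p = 0`, where row 1 has only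
row 0 before it. -/
theorem IsElementary.cost_eq_iff {g : GInf x n} {p : ℕ} {c : ℤ} (hg : IsElementary g p c)
    (w : GInf x n) :
    cost w = cost g + cost (g⁻¹ * w) ↔
      GeInv w ⟨p, Nat.lt_of_succ_lt hg.1⟩ ⟨p + 1, hg.1⟩ c := by
  have hp := hg.1
  have hc := hg.2.1
  have h := cost_mul_eq_iff hx g (g⁻¹ * w)
  rw [mul_inv_cancel_left] at h
  rw [h]
  constructor
  · intro h
    have h1 := (h ⟨p, by omega⟩ ⟨p + 1, hp⟩ (by simp [Fin.lt_def])).2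
    rw [hg.expo_apply hx] at h1
    simpa [Fin.lt_def, hg.perm_apply] using h1
  · intro h i j hij
    by_cases hi : i = ⟨p, by omega⟩ ∧ j = ⟨p + 1, hp⟩
    · rw [hi.1, hi.2]
      refine ⟨fun h1 => ?_, fun _ => ?_⟩
      · simp [Fin.lt_def, hg.perm_apply] at h1
      · rw [hg.expo_apply hx]
        simpa using h
    · simp only [Fin.ext_iff, Fin.lt_def] at hi hij
      refine ⟨fun _ => Or.inl ?_, fun h1 => ?_⟩
      · rw [hg.expo_apply hx]
        split_ifs <;> omega
      · simp only [Fin.lt_def, hg.perm_apply] at h1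
        split_ifs at h1 <;> omega

/-- If no generator divides `w`, then consecutive rows are in order and every row after the first
has exponent 0, by induction on the row. So the permutation is trivial, and the first exponent
vanishes because the exponents sum to 0. -/
theorem exists_atom_of_ne_one (w : GInf x n) (hw : w ≠ 1) :
    ∃ g p c, IsElementary g p c ∧ cost w = cost g + cost (g⁻¹ * w) := by
  by_contra! hcon
  apply hw
  have hno : ∀ p (hp : p + 1 < n) c, (p = 0 ∨ c = 0) →
      ¬ GeInv w ⟨p, Nat.lt_of_succ_lt hp⟩ ⟨p + 1, hp⟩ c := fun p hp c hc h => by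
    obtain ⟨g, hg⟩ := exists_isElementary x hp hc
    exact hcon g p c hg ((hg.cost_eq_iff hx w).2 h)
  have key : ∀ p (hp : p + 1 < n), perm w ⟨p, Nat.lt_of_succ_lt hp⟩ < perm w ⟨p + 1, hp⟩ ∧
      expo w ⟨p + 1, hp⟩ = 0 := by
    intro p
    induction p with
    | zero =>
      intro hp
      -- The exponent of `t` is free, so it can match that of row 0 and exclude an inversion there.
      -- For later rows, the exponent 0 required by `s_j` comes from the previous step.
      have h := hno 0 hp (expo w ⟨0, by omega⟩) (Or.inl rfl)
      simp only [GeInv] at h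
      tauto
    | succ p ih =>
      intro hp
      have h := hno (p + 1) hp 0 (Or.inr rfl)
      have h1 := (ih (by omega)).2
      simp only [GeInv] at h
      tauto
  have hexp : ∀ i : Fin n, (i : ℕ) ≠ 0 → expo w i = 0 := by
    rintro ⟨i, hi⟩ h0
    obtain ⟨p, rfl⟩ := Nat.exists_eq_succ_of_ne_zero h0
    exact (key p hi).2
  have hmono : StrictMono (perm w) := by
    cases n with
    | zero => exact fun i => i.elim0
    | succ m => exact Fin.strictMono_iff_lt_succ.2 fun i => (key i (by omega)).1
  have hperm : perm w = 1 := Equiv.ext fun i =>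
    congrFun (hmono.range_inj strictMono_id |>.1 (by simp)) i
  refine gInf_ext (hperm.trans hasCoords_one.perm_eq.symm) ?_
  rw [hasCoords_one.expo_eq hx]
  funext i
  by_cases h0 : (i : ℕ) = 0
  · rw [Pi.zero_apply, ← sum_expo hx w]
    exact (Finset.sum_eq_single i (fun j _ hj => hexp j fun h => hj (Fin.ext (h.trans h0.symm)))
      (by simp)).symm
  · exact hexp i h0

theorem exists_word (hn : 2 ≤ n) (w : GInf x n) :
    ∃ l : List (GInf x n), (∀ s ∈ l, s ∈ genX x n) ∧ l.prod = w ∧ l.length = cost w := by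
  induction hw : cost w generalizing w with
  | zero =>
    by_cases h1 : w = 1
    · exact ⟨[], by simp, by simp [h1], rfl⟩
    · obtain ⟨g, p, c, hg, h⟩ := exists_atom_of_ne_one hx w h1
      rw [hg.cost_eq hx] at h
      omega
  | succ m ih =>
    have h1 : w ≠ 1 := by
      rintro rfl
      rw [cost_one hx] at hw
      omega
    obtain ⟨g, p, c, hg, h⟩ := exists_atom_of_ne_one hx w h1
    rw [hg.cost_eq hx] at h
    obtain ⟨l, hl, hp, hlen⟩ := ih (g⁻¹ * w) (by omega)
    refine ⟨g :: l, ?_, by simp [hp], by simp [hlen]⟩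
    rintro s hs
    rcases List.mem_cons.1 hs with rfl | hs
    · exact (mem_genX_iff hn s).2 ⟨p, c, hg⟩
    · exact hl s hs

theorem closure_genX (hn : 2 ≤ n) : Submonoid.closure (genX x n) = ⊤ := by
  refine (Submonoid.eq_top_iff' _).2 fun w => ?_
  obtain ⟨l, hl, rfl, -⟩ := exists_word hx hn w
  exact Submonoid.list_prod_mem _ fun s hs => Submonoid.subset_closure (hl s hs)

/-- Peeling off generators that lower the cost yields a word of length `cost w`; no word is shorter,
since the cost is subadditive and equals 1 on generators. -/
theorem wordLength_eq_cost (hn : 2 ≤ n) (w : GInf x n) : wordLength (genX x n) w = cost w := by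
  apply le_antisymm
  · obtain ⟨l, hl, rfl, h⟩ := exists_word hx hn w
    exact h ▸ wordLength_prod_le l hl
  · obtain ⟨l, hl, rfl, h⟩ := exists_reduced_word (closure_genX hx hn) w
    rw [← h]
    clear h
    induction l with
    | nil => simp [cost_one hx]
    | cons s l ih =>
      obtain ⟨p, c, hs⟩ := (mem_genX_iff hn s).1 (hl s (by simp))
      have h1 := ih fun t ht => hl t (by simp [ht])
      have h2 := cost_mul_le hx s l.prod
      rw [hs.cost_eq hx] at h2
      rw [List.prod_cons, List.length_cons]
      omega

theorem divL_genX_iff (hn : 2 ≤ n) (v w : GInf x n) :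
    DivL (genX x n) v w ↔ ∀ i j, i < j → PairLe v w i j := by
  have h := cost_mul_eq_iff hx v (v⁻¹ * w)
  rw [mul_inv_cancel_left] at h
  rw [divL_iff, wordLength_eq_cost hx hn, wordLength_eq_cost hx hn, wordLength_eq_cost hx hn, h]

theorem IsElementary.divL_iff (hn : 2 ≤ n) {g : GInf x n} {p : ℕ} {c : ℤ} (hg : IsElementary g p c)
    (w : GInf x n) : DivL (genX x n) g w ↔
      GeInv w ⟨p, Nat.lt_of_succ_lt hg.1⟩ ⟨p + 1, hg.1⟩ c := by
  rw [_root_.divL_iff, wordLength_eq_cost hx hn, wordLength_eq_cost hx hn,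
    wordLength_eq_cost hx hn, hg.cost_eq_iff hx]

end Generators

/-! ### The interval of a power of `λ` -/

section Lambda

variable {K : Type*} [Field K] {n : ℕ} {x : Kˣ}

theorem perm_lam_zpow (x : Kˣ) (n : ℕ) (k : ℤ) : perm (lam x n ^ k) = 1 := by
  have h : ∀ g h : GInf x n, perm g = 1 → perm h = 1 → perm (g * h⁻¹) = 1 := fun g h hg hh => by
    have := perm_mul (g * h⁻¹) h
    rw [inv_mul_cancel_right, hg, hh, one_mul] at this
    exact this.symm
  have hlam : perm (lam x n) = 1 := by
    refine (monoMatrix_injective (v := lamDiag x n) ((hasCoords _).symm.trans ?_)).1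
    ext i j
    by_cases h : i = j <;> simp [monoMatrix, lam, h]
  induction k using Int.induction_on with
  | zero => rw [zpow_zero, hasCoords_one.perm_eq]
  | succ k ih => rw [zpow_add_one, perm_mul, ih, hlam, one_mul]
  | pred k ih => rw [zpow_sub_one, h _ _ ih hlam]

theorem val_swap (p q i : Fin n) :
    (i : ℕ) = p ∧ (Equiv.swap p q i : ℕ) = q ∨ (i : ℕ) = q ∧ (Equiv.swap p q i : ℕ) = p ∨
      (i : ℕ) ≠ p ∧ (i : ℕ) ≠ q ∧ (Equiv.swap p q i : ℕ) = i := by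
  rw [Equiv.swap_apply_def]
  simp only [Fin.ext_iff]
  split_ifs <;> omega

variable (x) in
/-- Coordinates of a join of two generators. -/
def HasJoinCoords (k : ℤ) {p q : ℕ} (hp : p + 1 < n) (hq : q + 1 < n) (c d : ℤ) : Prop :=
  ∃ (σ : Equiv.Perm (Fin n)) (a : Fin n → ℤ), ∑ i, a i = 0 ∧
    ∀ m : GInf x n, (∀ i, perm m i = σ i) → (∀ i, expo m i = a i) →
      (∀ i j, i < j → perm m i < perm m j → expo m j = 0 ∨ expo m j = k) ∧
      GeInv m ⟨p, Nat.lt_of_succ_lt hp⟩ ⟨p + 1, hp⟩ c ∧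
      GeInv m ⟨q, Nat.lt_of_succ_lt hq⟩ ⟨q + 1, hq⟩ d ∧
      ∀ e ∈ intervalL (genX x n) (lam x n ^ k),
        GeInv e ⟨p, Nat.lt_of_succ_lt hp⟩ ⟨p + 1, hp⟩ c →
        GeInv e ⟨q, Nat.lt_of_succ_lt hq⟩ ⟨q + 1, hq⟩ d → ∀ i j, i < j → PairLe m e i j

/-- The generators commute and their product is the join: its only inversions are the two given
pairs, and all its other pairs have lower exponent 0. -/
theorem hasJoinCoords_far {k : ℤ} {p q : ℕ} (hp : p + 1 < n) (hq : q + 1 < n) (hpq : p + 1 < q)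
    {c : ℤ} (hc : p = 0 ∨ c = 0) : HasJoinCoords x k hp hq c 0 := by
  refine ⟨Equiv.swap ⟨p, by omega⟩ ⟨p + 1, hp⟩ * Equiv.swap ⟨q, by omega⟩ ⟨q + 1, hq⟩,
    dipole ⟨p, by omega⟩ ⟨p + 1, hp⟩ c, sum_dipole _ _ _, fun m hσ ha => ?_⟩
  have hσ' : ∀ i : Fin n, (i : ℕ) = p ∧ (perm m i : ℕ) = p + 1 ∨ (i : ℕ) = p + 1 ∧ (perm m i : ℕ) = p ∨
      (i : ℕ) = q ∧ (perm m i : ℕ) = q + 1 ∨ (i : ℕ) = q + 1 ∧ (perm m i : ℕ) = q ∨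
      (i : ℕ) ≠ p ∧ (i : ℕ) ≠ p + 1 ∧ (i : ℕ) ≠ q ∧ (i : ℕ) ≠ q + 1 ∧ (perm m i : ℕ) = i :=
    fun i => by
      have h1 := val_swap ⟨q, Nat.lt_of_succ_lt hq⟩ ⟨q + 1, hq⟩ i
      have h2 := val_swap ⟨p, Nat.lt_of_succ_lt hp⟩ ⟨p + 1, hp⟩
        (Equiv.swap ⟨q, Nat.lt_of_succ_lt hq⟩ ⟨q + 1, hq⟩ i)
      rw [hσ, Equiv.Perm.mul_apply]
      simp only at h1 h2
      omega
  simp only [dipole, Fin.ext_iff] at ha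
  refine ⟨fun i j hij h => ?_, ?_, ?_, fun e he hse hte i j hij => ⟨fun h => Or.inl ?_, fun h => ?_⟩⟩
  · rw [Fin.lt_def] at hij h
    have := hσ' i
    have := hσ' j
    have := ha j
    omega
  · have h1 := hσ' ⟨p, by omega⟩
    have h2 := hσ' ⟨p + 1, by omega⟩
    have h3 := ha ⟨p, by omega⟩
    simp only [if_true] at h1 h2 h3
    simp only [GeInv, Fin.lt_def]
    omega
  · have h1 := hσ' ⟨q, by omega⟩
    have h2 := hσ' ⟨q + 1, by omega⟩
    have h3 := ha ⟨q, by omega⟩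
    simp only at h1 h2 h3
    simp only [GeInv, Fin.lt_def]
    omega
  · rw [Fin.lt_def] at hij h
    have := hσ' i
    have := hσ' j
    have := ha j
    omega
  · have hij' : ((i : ℕ) = p ∧ (j : ℕ) = p + 1) ∨ ((i : ℕ) = q ∧ (j : ℕ) = q + 1) := by
      rw [Fin.lt_def] at hij h
      have := hσ' i
      have := hσ' j
      omega
    have hai := ha i
    rcases hij' with ⟨h1, h2⟩ | ⟨h1, h2⟩
    · obtain rfl : i = ⟨p, Nat.lt_of_succ_lt hp⟩ := Fin.ext h1
      obtain rfl : j = ⟨p + 1, hp⟩ := Fin.ext h2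
      rwa [show expo m _ = c by simpa using hai]
    · obtain rfl : i = ⟨q, Nat.lt_of_succ_lt hq⟩ := Fin.ext h1
      obtain rfl : j = ⟨q + 1, hq⟩ := Fin.ext h2
      rwa [show expo m _ = 0 by omega]

variable (hx : Function.Injective fun m : ℤ => x ^ m)

include hx

theorem expo_lam_zpow (k : ℤ) (i : Fin n) (hi : (i : ℕ) ≠ 0) : expo (lam x n ^ k) i = k := by
  have hlam : expo (lam x n) i = 1 := by
    have h : HasCoords (lam x n) 1 fun i => if (i : ℕ) = 0 then -((n : ℤ) - 1) else 1 := by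
      change Matrix.diagonal _ = _
      ext a b
      by_cases h : a = b
      · subst h
        by_cases h0 : (a : ℕ) = 0 <;> simp [monoMatrix, lamDiag, h0]
      · simp [monoMatrix, h]
    rw [h.expo_eq hx]
    simp [hi]
  induction k using Int.induction_on with
  | zero => simp [hasCoords_one.expo_eq hx]
  | succ k ih => rw [zpow_add_one, expo_mul hx, ih, perm_lam_zpow, Equiv.Perm.one_apply, hlam]
  | pred k ih =>
    have h := expo_mul hx (lam x n ^ (-(k : ℤ) - 1)) (lam x n) i
    rw [← zpow_add_one, sub_add_cancel, ih, perm_lam_zpow, Equiv.Perm.one_apply, hlam] at h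
    omega

theorem gTranspose_lam_zpow (k : ℤ) : gTranspose hx (lam x n ^ k) = lam x n ^ k := by
  apply gInf_ext
  · rw [perm_gTranspose, perm_lam_zpow, inv_one]
  · funext i
    rw [expo_gTranspose, perm_lam_zpow, inv_one, Equiv.Perm.one_apply]

/-- In `λ^k` every pair is in order with lower exponent `k`. As `k ≠ 0`, this lies above any
inversion, so only the pairs of `w` in order impose a condition. -/
theorem mem_intervalL_lam_zpow (hn : 2 ≤ n) {k : ℤ} (hk : k ≠ 0) (w : GInf x n) :
    w ∈ intervalL (genX x n) (lam x n ^ k) ↔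
      ∀ i j, i < j → perm w i < perm w j → expo w j = 0 ∨ expo w j = k := by
  rw [mem_intervalL, divL_genX_iff hx hn]
  refine forall_congr' fun i => forall_congr' fun j => forall_congr' fun hij => ?_
  have hj : expo (lam x n ^ k) j = k := expo_lam_zpow hx k j (by rw [Fin.lt_def] at hij; omega)
  simp only [PairLe, GeInv, hj, perm_lam_zpow, Equiv.Perm.one_apply, hij, hij.not_gt, true_and,
    forall_const, IsEmpty.forall_iff, and_true, hk, ne_eq, not_false_eq_true, implies_true]
  exact imp_congr_right fun _ => or_congr_right eq_comm

theorem isIntervalReversal_gTranspose (hn : 2 ≤ n) (k : ℤ) :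
    IsIntervalReversal (genX x n) (lam x n ^ k) (gTranspose hx) where
  map_mul := gTranspose_mul hx
  involutive := gTranspose_involutive hx
  wordLength_map w := by
    rw [wordLength_eq_cost hx hn, wordLength_eq_cost hx hn, cost_gTranspose]
  map_top := gTranspose_lam_zpow hx k

theorem isBalanced_lam_zpow (hn : 2 ≤ n) {k : ℤ} (hk : k ≠ 0) :
    IsBalanced (genX x n) (lam x n ^ k) := by
  ext w
  rw [(isIntervalReversal_gTranspose hx hn k).mem_intervalR_iff, mem_intervalL_lam_zpow hx hn hk,
    mem_intervalL_lam_zpow hx hn hk]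
  simp only [perm_gTranspose, expo_gTranspose]
  constructor
  · intro h i j hij hw
    exact h _ _ hw (by simpa using hij)
  · intro h i j hij hw
    simpa using h _ _ hw (by simpa using hij)

/-- Transitivity of inversions below an element of the interval. -/
theorem GeInv.trans (hn : 2 ≤ n) {k : ℤ} (hk : k ≠ 0) {w : GInf x n}
    (hw : w ∈ intervalL (genX x n) (lam x n ^ k)) {i j l : Fin n} (hij : i < j) (hjl : j < l)
    {c : ℤ} (h1 : GeInv w i j c) (h2 : GeInv w j l 0) : GeInv w i l c := by
  rw [mem_intervalL_lam_zpow hx hn hk] at hw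
  have h3 := hw i j hij
  have h4 : perm w i ≠ perm w j := fun e => hij.ne ((perm w).injective e)
  have h5 : perm w j ≠ perm w l := fun e => hjl.ne ((perm w).injective e)
  unfold GeInv at *
  -- If `j`, `l` are inverted, then row `j` has exponent 0, so `i`, `j` are inverted too and row `i`
  -- has exponent `c`. If `j`, `l` are in order, then row `l` has nonzero exponent, and an inversion
  -- of `i`, `l` forces one of `i`, `j`.
  omega

/-- A common upper bound cannot invert rows 0 and 1, since the exponent would be both `c` and `d`.
It keeps them in order with nonzero lower exponent, which the interval forces to be `k`. The join is
therefore independent of `c` and `d`. -/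
theorem hasJoinCoords_zero (hn : 2 ≤ n) {k : ℤ} (hk : k ≠ 0) (hp : 0 + 1 < n) {c d : ℤ}
    (hcd : c ≠ d) : HasJoinCoords x k hp hp c d := by
  refine ⟨1, dipole ⟨0 + 1, hp⟩ ⟨0, by omega⟩ k, sum_dipole _ _ _, fun m hσ ha => ?_⟩
  simp only [dipole, Fin.ext_iff] at ha
  simp only [Equiv.Perm.one_apply] at hσ
  refine ⟨fun i j hij _ => ?_, ?_, ?_, fun e he hse hte i j hij => ?_⟩
  · rw [Fin.lt_def] at hij
    have := ha j
    omega
  · simp [GeInv, hσ, ha, hk, Fin.lt_def]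
  · simp [GeInv, hσ, ha, hk, Fin.lt_def]
  · refine ⟨fun _ => ?_, fun h => absurd h (by simpa only [hσ] using hij.not_gt)⟩
    have haj := ha j
    by_cases hj : (j : ℕ) = 0 + 1
    · obtain rfl : j = ⟨0 + 1, hp⟩ := Fin.ext hj
      obtain rfl : i = ⟨0, Nat.lt_of_succ_lt hp⟩ :=
        Fin.ext (by rw [Fin.lt_def] at hij; simp only at *; omega)
      have h1 := (mem_intervalL_lam_zpow hx hn hk e).1 he _ _ hij
      have h2 : perm e ⟨0, Nat.lt_of_succ_lt hp⟩ ≠ perm e ⟨0 + 1, hp⟩ :=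
        fun h => hij.ne ((perm e).injective h)
      unfold GeInv at hse hte
      omega
    · left
      rw [Fin.lt_def] at hij
      omega

/-- The braid relation: the join reverses three consecutive rows. Two of its inversions are the
given ones, and `GeInv.trans` supplies that of the outer rows. -/
theorem hasJoinCoords_adjacent (hn : 2 ≤ n) {k : ℤ} (hk : k ≠ 0) {p : ℕ} (hp : p + 1 < n)
    (hq : p + 1 + 1 < n) {c : ℤ} (hc : p = 0 ∨ c = 0) : HasJoinCoords x k hp hq c 0 := by
  refine ⟨Equiv.swap ⟨p, by omega⟩ ⟨p + 2, hq⟩, dipole ⟨p, by omega⟩ ⟨p + 2, hq⟩ c,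
    sum_dipole _ _ _, fun m hσ ha => ?_⟩
  have hσ' : ∀ i : Fin n, (i : ℕ) = p ∧ (perm m i : ℕ) = p + 2 ∨ (i : ℕ) = p + 2 ∧ (perm m i : ℕ) = p ∨
      (i : ℕ) ≠ p ∧ (i : ℕ) ≠ p + 2 ∧ (perm m i : ℕ) = i := fun i => by
    rw [hσ]
    exact val_swap ⟨p, Nat.lt_of_succ_lt hp⟩ ⟨p + 2, hq⟩ i
  simp only [dipole, Fin.ext_iff] at ha
  refine ⟨fun i j hij h => ?_, ?_, ?_, fun e he hse hte i j hij => ⟨fun h => Or.inl ?_, fun h => ?_⟩⟩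
  · rw [Fin.lt_def] at hij h
    have := hσ' i
    have := hσ' j
    have := ha j
    omega
  · have h1 := hσ' ⟨p, by omega⟩
    have h2 := hσ' ⟨p + 1, by omega⟩
    have h3 := ha ⟨p, by omega⟩
    simp only [if_true] at h1 h2 h3
    simp only [GeInv, Fin.lt_def]
    omega
  · have h1 := hσ' ⟨p + 1, by omega⟩
    have h2 := hσ' ⟨p + 1 + 1, by omega⟩
    have h3 := ha ⟨p + 1, by omega⟩
    simp only at h1 h2 h3
    simp only [GeInv, Fin.lt_def]
    omega
  · rw [Fin.lt_def] at hij h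
    have := hσ' i
    have := hσ' j
    have := ha j
    omega
  · have hij' : ((i : ℕ) = p ∧ (j : ℕ) = p + 1) ∨ ((i : ℕ) = p ∧ (j : ℕ) = p + 2) ∨
        ((i : ℕ) = p + 1 ∧ (j : ℕ) = p + 2) := by
      rw [Fin.lt_def] at hij h
      have := hσ' i
      have := hσ' j
      omega
    have hai := ha i
    rcases hij' with ⟨h1, h2⟩ | ⟨h1, h2⟩ | ⟨h1, h2⟩
    · obtain rfl : i = ⟨p, Nat.lt_of_succ_lt hp⟩ := Fin.ext h1
      obtain rfl : j = ⟨p + 1, hp⟩ := Fin.ext h2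
      rwa [show expo m _ = c by simpa using hai]
    · obtain rfl : i = ⟨p, Nat.lt_of_succ_lt hp⟩ := Fin.ext h1
      obtain rfl : j = ⟨p + 1 + 1, hq⟩ := Fin.ext h2
      rw [show expo m _ = c by simpa using hai]
      exact hse.trans hx hn hk he (by simp [Fin.lt_def]) (by simp [Fin.lt_def]) hte
    · obtain rfl : i = ⟨p + 1, hp⟩ := Fin.ext h1
      obtain rfl : j = ⟨p + 1 + 1, hq⟩ := Fin.ext h2
      rwa [show expo m _ = 0 by simpa using hai]

/-- Joins of two generators. -/
theorem exists_join_of_elementary (hn : 2 ≤ n) {k : ℤ} (hk : k ≠ 0) {s t : GInf x n} {p q : ℕ}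
    {c d : ℤ} (hs : IsElementary s p c) (ht : IsElementary t q d) (hpq : p ≤ q) :
    ∃ m ∈ intervalL (genX x n) (lam x n ^ k), DivL (genX x n) s m ∧ DivL (genX x n) t m ∧
      ∀ e ∈ intervalL (genX x n) (lam x n ^ k), DivL (genX x n) s e → DivL (genX x n) t e →
        DivL (genX x n) m e := by
  have hc := hs.2.1
  have hd := ht.2.1
  by_cases hcd : p = q ∧ c = d
  · obtain ⟨rfl, rfl⟩ := hcd
    refine ⟨s, mem_intervalL.2 ((hs.divL_iff hx hn _).2 ⟨fun _ => ?_, fun h => ?_⟩),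
      DivL.refl s, (ht.divL_iff hx hn s).2 ((hs.divL_iff hx hn s).1 (DivL.refl s)),
      fun e _ he _ => he⟩
    · rwa [expo_lam_zpow hx k _ (by simp)]
    · rw [perm_lam_zpow] at h
      simp [Fin.lt_def] at h
  simp only [hs.divL_iff hx hn, ht.divL_iff hx hn]
  suffices HasJoinCoords x k hs.1 ht.1 c d by
    obtain ⟨σ, a, ha, h⟩ := this
    obtain ⟨m, hm⟩ := exists_of_coords (x := x) σ a ha
    obtain ⟨h1, h2, h3, h4⟩ := h m (fun i => by rw [hm.perm_eq]) (fun i => by rw [hm.expo_eq hx])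
    exact ⟨m, (mem_intervalL_lam_zpow hx hn hk m).2 h1, h2, h3,
      fun e he hse hte => (divL_genX_iff hx hn m e).2 (h4 e he hse hte)⟩
  rcases hpq.lt_or_eq with hlt | rfl
  · obtain rfl : d = 0 := by omega
    rcases (Nat.succ_le_of_lt hlt).lt_or_eq with hlt' | rfl
    · exact hasJoinCoords_far hs.1 ht.1 hlt' hc
    · exact hasJoinCoords_adjacent hx hn hk hs.1 ht.1 hc
  · obtain rfl : p = 0 := by omega
    exact hasJoinCoords_zero hx hn hk hs.1 fun h => hcd ⟨rfl, h⟩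

end Lambda

theorem mainTheorem1 {F K : Type*} [Field F] [Field K] [Algebra F K]
    (x : Kˣ) (hx : Transcendental F (x : K)) (n : ℕ) (hn : 2 ≤ n) (k : ℤ) (hk : k ≠ 0) :
    IsIntervalGarsideMonoid (genX x n) (lam x n ^ k) ∧
    ∃ (G : Type _) (_ : Group G) (ι : IntervalMonoid (genX x n) (lam x n ^ k) →* G),
      IsGroupOfFractions ι := by
  -- Transcendence enters only through the infinite order of `x`: a root of unity would be
  -- algebraic.
  have hx' : Function.Injective fun m : ℤ => x ^ m := by
    refine injective_zpow_iff_not_isOfFinOrder.2 fun h => hx ?_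
    obtain ⟨m, hm, hxm⟩ := isOfFinOrder_iff_pow_eq_one.1 h
    have hxm' : (x : K) ^ m = 1 := by rw [← Units.val_pow_eq_pow_val, hxm, Units.val_one]
    exact IsAlgebraic.of_pow hm (hxm' ▸ isAlgebraic_one)
  have hbal := isBalanced_lam_zpow hx' hn hk
  have hS := closure_genX hx' hn
  have hG : IsIntervalGarsideMonoid (genX x n) (lam x n ^ k) := by
    refine IsJoinInterval.isIntervalGarsideMonoid ⟨hS, hbal, hbal.exists_join hS ?_⟩
      (isIntervalReversal_gTranspose hx' hn k)
    intro s hs t ht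
    obtain ⟨p, c, hs⟩ := (mem_genX_iff hn s).1 hs
    obtain ⟨q, d, ht⟩ := (mem_genX_iff hn t).1 ht
    rcases le_total p q with hpq | hpq
    · exact exists_join_of_elementary hx' hn hk hs ht hpq
    · obtain ⟨m, hm, h1, h2, h3⟩ := exists_join_of_elementary hx' hn hk ht hs hpq
      exact ⟨m, hm, h2, h1, fun e he hse hte => h3 e he hte hse⟩
  exact ⟨hG, hG.garside.exists_isGroupOfFractions⟩
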